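/- Let $M$ be a smooth $3$-dimensional manifold with smooth tensor fields $(\varphi,\xi,\eta,g)$, where $\varphi$ is of type $(1,1)$, $\xi$ is a vector field, $\eta$ is a $1$-form and $g$ is a Riemannian metric with Levi-Civita connection $\nabla$, such that $$\varphi^2=-I+\eta\otimes\xi,\qquad \eta(\xi)=1,\qquad g(\varphi X,\varphi Y)=g(X,Y)-\eta(X)\eta(Y)$$ for all vector fields $X,Y$. Suppose that $M$ is Kenmotsu, i.e. $$(\nabla_X\varphi)Y=g(\varphi X,Y)\,\xi-\eta(Y)\,\varphi X$$ for all vector fields $X,Y$. Let $R(X,Y)=[\nabla_X,\nabla_Y]-\nabla_{[X,Y]}$ be the curvature tensor and let $$S^*(X,Y)=\tfrac12\operatorname{trace}\bigl(Z\mapsto R(X,\varphi Y)\varphi Z\bigr)$$ be the $*$-Ricci tensor. If $g$ is a $*$-Ricci soliton, i.e. there are a constant $\lambda\in\mathbb R$ and a smooth vector field $V$ on $M$ with $$\mathcal L_V g+2S^*+2\lambda g=0,$$ then $M$ has constant sectional curvature $-1$. -/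

import Mathlib

set_option maxSynthPendingDepth 3

open scoped Manifold ContDiff

noncomputable section

namespace KenmotsuGeometry

/-! ### Tensor calculus on a coordinate domain

`h : E → E →L[ℝ] E →L[ℝ] ℝ` is the coordinate expression of a Riemannian metric, and `D` denotes
the ordinary derivative (`fderiv`) in the coordinate space `E`. -/

section Coordinates

variable {E : Type*} [NormedAddCommGroup E] [NormedSpace ℝ E]

/-- Christoffel symbols of the first kind:
`(u, v, w) ↦ (1/2) (D_u h (v, w) + D_v h (u, w) - D_w h (u, v))`. -/
def christoffelLower (h : E → E →L[ℝ] E →L[ℝ] ℝ) (y : E) : E →L[ℝ] E →L[ℝ] E →L[ℝ] ℝ :=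
  (1 / 2 : ℝ) • (fderiv ℝ h y + (fderiv ℝ h y).flip
    - ContinuousLinearMap.comp (ContinuousLinearMap.flipₗᵢ ℝ E E ℝ :
        (E →L[ℝ] E →L[ℝ] ℝ) →L[ℝ] E →L[ℝ] E →L[ℝ] ℝ) (fderiv ℝ h y).flip)

theorem christoffelLower_apply (h : E → E →L[ℝ] E →L[ℝ] ℝ) (y u v w : E) :
    christoffelLower h y u v w =
      (1 / 2) * (fderiv ℝ h y u v w + fderiv ℝ h y v u w - fderiv ℝ h y w u v) := by
  simp [christoffelLower]

/-- Christoffel symbols of the second kind, i.e. the Levi-Civita connection in coordinates: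
`∇_X Y = D_X Y + Γ(X, Y)`. The index is raised with the inverse of
`h y : E → (E → ℝ)`, `u ↦ h y u ·`, which is invertible when `h y` is positive definite. -/
def christoffel (h : E → E →L[ℝ] E →L[ℝ] ℝ) (y : E) : E →L[ℝ] E →L[ℝ] E :=
  ContinuousLinearMap.compL ℝ E (E →L[ℝ] ℝ) E (h y).inverse ∘L christoffelLower h y

theorem christoffel_apply (h : E → E →L[ℝ] E →L[ℝ] ℝ) (y u v : E) :
    christoffel h y u v = (h y).inverse (christoffelLower h y u v) := rfl

/-- The Riemann curvature operator `w ↦ R(u, v) w`, with the sign convention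
`R(X, Y) = [∇_X, ∇_Y] - ∇_{[X, Y]}`; here it is evaluated on vector fields with constant
coefficients `u`, `v` (whose bracket vanishes), so that
`R(u, v) = (D_u Γ)(v) - (D_v Γ)(u) + Γ(u) Γ(v) - Γ(v) Γ(u)`. -/
def curvature (h : E → E →L[ℝ] E →L[ℝ] ℝ) (y u v : E) : E →L[ℝ] E :=
  fderiv ℝ (christoffel h) y u v - fderiv ℝ (christoffel h) y v u
    + christoffel h y u ∘L christoffel h y v - christoffel h y v ∘L christoffel h y u

/-- Sectional curvature of the plane spanned by `u` and `v`. -/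
def sectionalCurvature (h : E → E →L[ℝ] E →L[ℝ] ℝ) (y u v : E) : ℝ :=
  h y (curvature h y u v v) u / (h y u u * h y v v - h y u v ^ 2)

/-- Covariant derivative of a `(1,1)`-tensor field:
`(∇_u φ) v = (D_u φ) v + Γ(u, φ v) - φ Γ(u, v)`. -/
def covDerivEndo (h : E → E →L[ℝ] E →L[ℝ] ℝ) (φ : E → E →L[ℝ] E) (y u v : E) : E :=
  fderiv ℝ φ y u v + christoffel h y u (φ y v) - φ y (christoffel h y u v)

/-- Lie derivative of the metric:
`(£_V h)(u, v) = (D_V h)(u, v) + h(D_u V, v) + h(u, D_v V)`. -/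
def lieDerivMetric (h : E → E →L[ℝ] E →L[ℝ] ℝ) (V : E → E) (y u v : E) : ℝ :=
  fderiv ℝ h y (V y) u v + h y (fderiv ℝ V y u) v + h y u (fderiv ℝ V y v)

/-- The `*`-Ricci tensor `S*(u, v) = (1/2) trace (w ↦ R(u, φ v) φ w)`. -/
def starRicci (h : E → E →L[ℝ] E →L[ℝ] ℝ) (φ : E → E →L[ℝ] E) (y u v : E) : ℝ :=
  (1 / 2) * LinearMap.trace ℝ E (curvature h y u (φ y v) ∘L φ y : E →L[ℝ] E)

end Coordinates

/-! ### Coordinate expressions of tensor fields on a manifold -/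

section Manifold

variable {E : Type*} [NormedAddCommGroup E] [NormedSpace ℝ E]
  {M : Type*} [TopologicalSpace M] [ChartedSpace E M]

/-- Derivative at `y` of the inverse of the chart around `x₀`; it sends coordinate vectors to
tangent vectors of `M`. -/
def fromCoord (x₀ : M) (y : E) :
    E →L[ℝ] TangentSpace 𝓘(ℝ, E) ((extChartAt 𝓘(ℝ, E) x₀).symm y) :=
  mfderiv 𝓘(ℝ, E) 𝓘(ℝ, E) (extChartAt 𝓘(ℝ, E) x₀).symm y

/-- Derivative, at the point with coordinates `y`, of the chart around `x₀`; it sends tangent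
vectors of `M` to coordinate vectors. -/
def toCoord (x₀ : M) (y : E) :
    TangentSpace 𝓘(ℝ, E) ((extChartAt 𝓘(ℝ, E) x₀).symm y) →L[ℝ] E :=
  mfderiv 𝓘(ℝ, E) 𝓘(ℝ, E) (extChartAt 𝓘(ℝ, E) x₀) ((extChartAt 𝓘(ℝ, E) x₀).symm y)

/-- Coordinate expression of a vector field in the chart around `x₀`. -/
def coordVector (X : (x : M) → TangentSpace 𝓘(ℝ, E) x) (x₀ : M) (y : E) : E :=
  toCoord x₀ y (X ((extChartAt 𝓘(ℝ, E) x₀).symm y))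

/-- Coordinate expression of a `1`-form in the chart around `x₀`. -/
def coordForm (η : (x : M) → TangentSpace 𝓘(ℝ, E) x →L[ℝ] ℝ) (x₀ : M) (y : E) : E →L[ℝ] ℝ :=
  η ((extChartAt 𝓘(ℝ, E) x₀).symm y) ∘L fromCoord x₀ y

/-- Coordinate expression of a `(1,1)`-tensor field in the chart around `x₀`. -/
def coordEndo (φ : (x : M) → TangentSpace 𝓘(ℝ, E) x →L[ℝ] TangentSpace 𝓘(ℝ, E) x)
    (x₀ : M) (y : E) : E →L[ℝ] E :=
  toCoord x₀ y ∘L φ ((extChartAt 𝓘(ℝ, E) x₀).symm y) ∘L fromCoord x₀ y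

/-- Coordinate expression of a field of bilinear forms in the chart around `x₀`. -/
def coordBilin (g : (x : M) → TangentSpace 𝓘(ℝ, E) x →L[ℝ] TangentSpace 𝓘(ℝ, E) x →L[ℝ] ℝ)
    (x₀ : M) (y : E) : E →L[ℝ] E →L[ℝ] ℝ :=
  (fromCoord x₀ y).precomp ℝ ∘L g ((extChartAt 𝓘(ℝ, E) x₀).symm y) ∘L fromCoord x₀ y

theorem coordBilin_apply
    (g : (x : M) → TangentSpace 𝓘(ℝ, E) x →L[ℝ] TangentSpace 𝓘(ℝ, E) x →L[ℝ] ℝ)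
    (x₀ : M) (y u v : E) :
    coordBilin g x₀ y u v =
      g ((extChartAt 𝓘(ℝ, E) x₀).symm y) (fromCoord x₀ y u) (fromCoord x₀ y v) := rfl

end Manifold

/-! ### Kenmotsu manifolds and `*`-Ricci solitons

Equations between tensor fields on `M` are expressed in all charts `extChartAt _ x₀`, at all points
`y` of the image of the chart. -/

/-- An almost contact metric structure `(φ, ξ, η, g)` on `M`: smooth tensor fields with
`φ² = -I + η ⊗ ξ`, `η(ξ) = 1` and `g(φ X, φ Y) = g(X, Y) - η(X) η(Y)`. -/
structure AlmostContactMetric (E : Type*) [NormedAddCommGroup E] [NormedSpace ℝ E]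
    (M : Type*) [TopologicalSpace M] [ChartedSpace E M] [IsManifold 𝓘(ℝ, E) ∞ M] where
  /-- the Riemannian metric -/
  g : Bundle.ContMDiffRiemannianMetric 𝓘(ℝ, E) ∞ E (fun x : M ↦ TangentSpace 𝓘(ℝ, E) x)
  /-- the `(1,1)`-tensor field -/
  φ : (x : M) → TangentSpace 𝓘(ℝ, E) x →L[ℝ] TangentSpace 𝓘(ℝ, E) x
  /-- the characteristic vector field -/
  ξ : (x : M) → TangentSpace 𝓘(ℝ, E) x
  /-- the `1`-form -/
  η : (x : M) → TangentSpace 𝓘(ℝ, E) x →L[ℝ] ℝ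
  contMDiff_φ : ContMDiff 𝓘(ℝ, E) (𝓘(ℝ, E).prod 𝓘(ℝ, E →L[ℝ] E)) ∞
    (fun x ↦ Bundle.TotalSpace.mk' (E →L[ℝ] E) x (φ x))
  contMDiff_ξ : ContMDiff 𝓘(ℝ, E) (𝓘(ℝ, E).prod 𝓘(ℝ, E)) ∞
    (fun x ↦ Bundle.TotalSpace.mk' E x (ξ x))
  contMDiff_η : ContMDiff 𝓘(ℝ, E) (𝓘(ℝ, E).prod 𝓘(ℝ, E →L[ℝ] ℝ)) ∞
    (fun x ↦ Bundle.TotalSpace.mk' (E →L[ℝ] ℝ) x (η x))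
  φ_φ : ∀ (x : M) (u : TangentSpace 𝓘(ℝ, E) x), φ x (φ x u) = -u + η x u • ξ x
  η_ξ : ∀ x : M, η x (ξ x) = 1
  g_φ_φ : ∀ (x : M) (u v : TangentSpace 𝓘(ℝ, E) x),
    g.inner x (φ x u) (φ x v) = g.inner x u v - η x u * η x v

variable {E : Type*} [NormedAddCommGroup E] [NormedSpace ℝ E]
  {M : Type*} [TopologicalSpace M] [ChartedSpace E M] [IsManifold 𝓘(ℝ, E) ∞ M]

/-- The Kenmotsu condition `(∇_X φ) Y = g(φ X, Y) ξ - η(Y) φ X`. -/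
def AlmostContactMetric.IsKenmotsu (A : AlmostContactMetric E M) : Prop :=
  ∀ x₀ : M, ∀ y ∈ (extChartAt 𝓘(ℝ, E) x₀).target, ∀ u v : E,
    covDerivEndo (coordBilin A.g.inner x₀) (coordEndo A.φ x₀) y u v =
      coordBilin A.g.inner x₀ y (coordEndo A.φ x₀ y u) v • coordVector A.ξ x₀ y
        - coordForm A.η x₀ y v • coordEndo A.φ x₀ y u

/-- The metric is a `*`-Ricci soliton: there are a constant `c` (the soliton constant `λ`) and a
smooth vector field `V` with `£_V g + 2 S* + 2 c g = 0`. -/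
def AlmostContactMetric.IsStarRicciSoliton (A : AlmostContactMetric E M) : Prop :=
  ∃ (c : ℝ) (V : (x : M) → TangentSpace 𝓘(ℝ, E) x),
    ContMDiff 𝓘(ℝ, E) (𝓘(ℝ, E).prod 𝓘(ℝ, E)) ∞ (fun x ↦ Bundle.TotalSpace.mk' E x (V x)) ∧
    ∀ x₀ : M, ∀ y ∈ (extChartAt 𝓘(ℝ, E) x₀).target, ∀ u v : E,
      lieDerivMetric (coordBilin A.g.inner x₀) (coordVector V x₀) y u v
        + 2 * starRicci (coordBilin A.g.inner x₀) (coordEndo A.φ x₀) y u v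
        + 2 * c * coordBilin A.g.inner x₀ y u v = 0

/-- Every plane tangent to `M` has sectional curvature `c`. -/
def HasConstantSectionalCurvature
    (g : Bundle.ContMDiffRiemannianMetric 𝓘(ℝ, E) ∞ E (fun x : M ↦ TangentSpace 𝓘(ℝ, E) x))
    (c : ℝ) : Prop :=
  ∀ x₀ : M, ∀ y ∈ (extChartAt 𝓘(ℝ, E) x₀).target, ∀ u v : E, LinearIndependent ℝ ![u, v] →
    sectionalCurvature (coordBilin g.inner x₀) y u v = c

end KenmotsuGeometry

end

namespace KenmotsuGeometry

/-! ### The soliton equations in an adapted frame -/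

section FrameAlgebra

variable {A : Type*} [CommRing A] [Algebra ℝ A] {D₀ D₁ D₂ : Derivation ℝ A A} {a b c r f p q : A}

/-! The statement is local. Near any point there is an orthonormal frame `e₀ = ξ`, `e₁`, `e₂ = φ
e₁`. Since `∇_X ξ = X - η(X) ξ`, its connection has only the unknowns `a, b, c = g(∇_{eᵢ} e₁, e₂)`
for `i = 1, 2, 0`. The contact distribution is integrable with umbilic leaves. Planes through `ξ`
have curvature `-1`, contact planes have curvature `r - 1`, where `r` is the Gauss curvature of the
leaf, and `S* = (r - 1)(g - η ⊗ η)`. So the claim is `r = 0`.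

Write `V = f e₀ + p e₁ + q e₂`. Differentiating the soliton equations shows that the leafwise
Hessian of `f` is `-(2r + λ)` times the metric. Scaling along `ξ` then forces `λ = 0`, and the Ricci
identity gives `2 dr = r df` on the leaves. Moreover `W = (p, q) - (1/2) grad f` is a conformal
field on each leaf with factor `1 - f`. Its integrability condition is `r (W f - 4f + 12) = 0`.
Differentiating this, with the leafwise constant `C = |grad f|² + 8r`, gives `r ((f + 3) C - 48 r) =
0`. Two more derivatives give `(r Dᵢ f)³ = 0`, so `r Dᵢ f = 0`, and the Hessian equation yields `r²
= 0`.

This is carried out in `curvature_eq_zero_of_frame_equations` for three derivations of a reduced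
commutative `ℝ`-algebra. Smooth functions on an open set have zero divisors, so nothing is divided
by `r`: the factor `r` is carried along and nilpotency ends the argument. The geometric input is
`covDeriv_frame`, `curvature_frame` and `starRicci_frame`. -/

theorem jacobi_of_frame_brackets
    (h12 : ∀ F, D₁ (D₂ F) - D₂ (D₁ F) = -a * D₁ F - b * D₂ F)
    (h01 : ∀ F, D₀ (D₁ F) - D₁ (D₀ F) = -D₁ F + c * D₂ F)
    (h02 : ∀ F, D₀ (D₂ F) - D₂ (D₀ F) = -D₂ F - c * D₁ F)
    (hind : ∀ x y, (∀ F, x * D₁ F + y * D₂ F = 0) → x = 0 ∧ y = 0) :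
    D₀ a = D₁ c - a + b * c ∧ D₀ b = D₂ c - b - a * c := by
  -- The Jacobi identity of `D₀, D₁, D₂` applied to `F` is a combination of `D₁ F` and `D₂ F`, whose
  -- coefficients vanish by independence.
  obtain ⟨h₁, h₂⟩ := hind (D₀ a - (D₁ c - a + b * c)) (D₀ b - (D₂ c - b - a * c)) fun F => by
    have e0 := congrArg D₀ (h12 F)
    have e1 := congrArg D₁ (h02 F)
    have e2 := congrArg D₂ (h01 F)
    simp only [map_sub, map_add, map_neg, Derivation.leibniz, smul_eq_mul, neg_mul] at e0 e1 e2
    linear_combination e0 - h01 (D₂ F) + h02 (D₁ F) - e1 + e2 - h12 (D₀ F) + 2 * h12 F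
      - a * h01 F - b * h02 F
  exact ⟨sub_eq_zero.1 h₁, sub_eq_zero.1 h₂⟩

/-- The flow of `ξ` scales the leaf metric by `e^{2t}`, hence its Gauss curvature `r` by `e^{-2t}`.
Algebraically this is a consequence of the two Jacobi relations. -/
theorem deriv_reeb_curvature
    (h12 : ∀ F, D₁ (D₂ F) - D₂ (D₁ F) = -a * D₁ F - b * D₂ F)
    (h01 : ∀ F, D₀ (D₁ F) - D₁ (D₀ F) = -D₁ F + c * D₂ F)
    (h02 : ∀ F, D₀ (D₂ F) - D₂ (D₀ F) = -D₂ F - c * D₁ F)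
    (ha : D₀ a = D₁ c - a + b * c) (hb : D₀ b = D₂ c - b - a * c)
    (hr : r = D₂ a - D₁ b - a ^ 2 - b ^ 2) : D₀ r = -2 * r := by
  have e1 := congrArg D₂ ha
  have e2 := congrArg D₁ hb
  simp only [map_sub, map_add, Derivation.leibniz, smul_eq_mul] at e1 e2
  rw [hr]
  simp only [map_sub, Derivation.leibniz, smul_eq_mul, pow_two]
  linear_combination e1 - e2 + h02 a - h01 b - h12 c - 2 * a * ha - 2 * b * hb

/-- The equations of a `*`-Ricci soliton on a three-dimensional Kenmotsu manifold, written in an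
adapted frame, force the sectional curvature `r - 1` of the contact planes to be `-1`. -/
theorem curvature_eq_zero_of_frame_equations [IsReduced A] (l : ℝ)
    (h12 : ∀ F, D₁ (D₂ F) - D₂ (D₁ F) = -a * D₁ F - b * D₂ F)
    (h01 : ∀ F, D₀ (D₁ F) - D₁ (D₀ F) = -D₁ F + c * D₂ F)
    (h02 : ∀ F, D₀ (D₂ F) - D₂ (D₀ F) = -D₂ F - c * D₁ F)
    (ha : D₀ a = D₁ c - a + b * c) (hb : D₀ b = D₂ c - b - a * c)
    (hr : r = D₂ a - D₁ b - a ^ 2 - b ^ 2)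
    (s00 : D₀ f + algebraMap ℝ A l = 0)
    (s01 : D₁ f - p + D₀ p - c * q = 0)
    (s02 : D₂ f - q + D₀ q + c * p = 0)
    (s11 : f + D₁ p - a * q + (r - 1) + algebraMap ℝ A l = 0)
    (s22 : f + D₂ q + b * p + (r - 1) + algebraMap ℝ A l = 0)
    (s12 : D₁ q + a * p + (D₂ p - b * q) = 0) : r = 0 := by
  have hr0 := deriv_reeb_curvature h12 h01 h02 ha hb hr
  generalize hl' : algebraMap ℝ A l = m at s00 s11 s22
  have l0 : D₀ m = 0 := by rw [← hl']; exact D₀.map_algebraMap l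
  have l1 : D₁ m = 0 := by rw [← hl']; exact D₁.map_algebraMap l
  have l2 : D₂ m = 0 := by rw [← hl']; exact D₂.map_algebraMap l
  have cancel : ∀ (n : ℕ) (x : A), n ≠ 0 → n * x = 0 → x = 0 := fun n x hn hx => by
    rw [← nsmul_eq_mul, ← Nat.cast_smul_eq_nsmul ℝ] at hx
    exact (smul_eq_zero.1 hx).resolve_left (Nat.cast_ne_zero.2 hn)
  have half : ∀ x : A, 2 * x = 0 → x = 0 := fun x hx => cancel 2 x two_ne_zero hx
  have n0 : D₀ (2 : A) = 0 := D₀.map_natCast 2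
  have n1 : ∀ n : ℕ, [n.AtLeastTwo] → D₁ (OfNat.ofNat n : A) = 0 := fun n _ => D₁.map_natCast n
  have n2 : ∀ n : ℕ, [n.AtLeastTwo] → D₂ (OfNat.ofNat n : A) = 0 := fun n _ => D₂.map_natCast n
  -- the Hessian of `f`
  have d00 := congrArg D₁ s00
  have d00' := congrArg D₂ s00
  have d01 := congrArg D₁ s01
  have d01' := congrArg D₂ s01
  have d02 := congrArg D₁ s02
  have d02' := congrArg D₂ s02
  have d11 := congrArg D₀ s11
  have d22 := congrArg D₀ s22
  have d12 := congrArg D₀ s12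
  simp only [map_add, map_sub, Derivation.leibniz, smul_eq_mul, map_zero, Derivation.map_one_eq_zero,
    l0, l1, l2, add_zero, sub_zero] at d00 d00' d01 d01' d02 d02' d11 d22 d12
  -- Comparing `D₁` of `s01` with `D₀` of `s11` eliminates the derivatives of `p` and `q`. With
  -- `H22` and `H12`, the leafwise Hessian of `f` is `-(2r + m)` times the metric.
  have H11 : D₁ (D₁ f) = a * D₂ f - 2 * r - m := by
    linear_combination d01 - d11 + h01 p - q * ha - a * s02 + hr0 + s00 + c * s12
  have H22 : D₂ (D₂ f) = -b * D₁ f - 2 * r - m := by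
    linear_combination d02' - d22 + h02 q + p * hb + b * s01 + hr0 + s00 - c * s12
  have Hsum : D₁ (D₂ f) + D₂ (D₁ f) = -a * D₁ f + b * D₂ f := by
    linear_combination d02 + d01' - d12 + h01 q + h02 p + p * ha - q * hb + a * s01 - b * s02
      + 2 * c * (s22 - s11)
  have H12 : D₁ (D₂ f) = -a * D₁ f := by
    have := half (D₁ (D₂ f) + a * D₁ f) (by linear_combination Hsum + h12 f)
    linear_combination this
  have H21 : D₂ (D₁ f) = b * D₂ f := by linear_combination Hsum - H12
  -- the soliton is steady
  have hm : m = 0 := by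
    -- Along `ξ` both the leafwise Hessian of `f` and `r` have weight `-2`, whereas `m` is constant.
    have e1 := congrArg D₀ H11
    have e2 := congrArg D₁ (h01 f)
    have e3 := congrArg D₁ d00
    simp only [map_add, map_sub, map_neg, Derivation.leibniz, smul_eq_mul, map_zero, l0,
      n0] at e1 e2 e3
    refine half m ?_
    linear_combination e1 - h01 (D₁ f) - e2 - e3 + D₂ f * ha + a * h02 f + 2 * H11 - 2 * hr0
      - c * H21 - c * H12 + a * d00'
  subst hm
  -- the gradient of the curvature
  have r1 : 2 * D₁ r = r * D₁ f := by
    -- Ricci identity: the third derivatives of `f` commute up to the leaf curvature `r`.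
    have e1 := congrArg D₁ H22
    have e2 := congrArg D₂ H12
    simp only [map_sub, map_neg, Derivation.leibniz, smul_eq_mul, map_zero, n1] at e1 e2
    linear_combination e1 - e2 - h12 (D₂ f) - b * H11 + b * H22 + a * H21 + a * H12 - D₁ f * hr
  have r2 : 2 * D₂ r = r * D₂ f := by
    have e1 := congrArg D₂ H11
    have e2 := congrArg D₁ H21
    simp only [map_sub, Derivation.leibniz, smul_eq_mul, map_zero, n2] at e1 e2
    linear_combination e1 - e2 + h12 (D₁ f) + a * H22 - a * H11 - b * H21 - b * H12 - D₂ f * hr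
  -- Since `2 D₁ r` is a multiple of `r`, differentiating `r * x = 0` along a leaf keeps the factor
  -- `r` outside.
  have transfer₁ : ∀ x, r * x = 0 → r * D₁ x = 0 := fun x hx => half _ <| by
    have e := congrArg D₁ hx
    simp only [Derivation.leibniz, smul_eq_mul, map_zero] at e
    linear_combination 2 * e - x * r1 - D₁ f * hx
  have transfer₂ : ∀ x, r * x = 0 → r * D₂ x = 0 := fun x hx => half _ <| by
    have e := congrArg D₂ hx
    simp only [Derivation.leibniz, smul_eq_mul, map_zero] at e
    linear_combination 2 * e - x * r2 - D₂ f * hx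
  -- the conformal field
  have halve : ∀ x y : A, ∃ z, 2 * z = 2 * x - y := fun x y => ⟨x - (1 / 2 : ℝ) • y, by
    rw [mul_sub, mul_smul_comm, ← smul_mul_assoc, sub_right_inj]
    have : (1 / 2 : ℝ) • (2 : A) = 1 := by
      rw [Algebra.smul_def, ← map_ofNat (algebraMap ℝ A) 2, ← map_mul]; norm_num
    rw [this, one_mul]⟩
  -- `(P, Q)` is `(p, q)` minus half the leafwise gradient of `f`; this cancels `r` from `s11` and
  -- `s22`. The form `2 * z` keeps all later identities over the integers.
  obtain ⟨P, hP⟩ := halve p (D₁ f)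
  obtain ⟨Q, hQ⟩ := halve q (D₂ f)
  -- `t` is the rotation part: the covariant derivative of `(P, Q)` on a leaf is `1 - f` times the
  -- identity plus `t` times a quarter turn.
  obtain ⟨t, ht⟩ : ∃ t, t = D₁ Q + a * P := ⟨_, rfl⟩
  have e1 := congrArg D₁ hP
  have e2 := congrArg D₂ hP
  have e3 := congrArg D₁ hQ
  have e4 := congrArg D₂ hQ
  simp only [map_sub, Derivation.leibniz, smul_eq_mul, n1, n2] at e1 e2 e3 e4
  have P1 : D₁ P = 1 - f + a * Q := by
    refine sub_eq_zero.1 (half _ ?_)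
    linear_combination e1 + 2 * s11 - H11 - a * hQ
  have Q2 : D₂ Q = 1 - f - b * P := by
    refine sub_eq_zero.1 (half _ ?_)
    linear_combination e4 + 2 * s22 - H22 + b * hP
  have Q1 : D₁ Q = t - a * P := by linear_combination -ht
  have P2 : D₂ P = b * Q - t := by
    refine sub_eq_zero.1 (half _ ?_)
    linear_combination e2 + e3 + 2 * s12 + 2 * ht + a * hP - b * hQ - H21 - H12
  clear e1 e2 e3 e4
  have e1 := congrArg D₁ P1
  have e2 := congrArg D₁ P2
  have e3 := congrArg D₂ P1
  have f1 := congrArg D₁ Q1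
  have f2 := congrArg D₁ Q2
  have f3 := congrArg D₂ Q1
  simp only [map_add, map_sub, Derivation.leibniz, smul_eq_mul, Derivation.map_one_eq_zero]
    at e1 e2 e3 f1 f2 f3
  -- Commuting `D₁` and `D₂` on `P` and on `Q` prolongs the conformal equation to the gradient of
  -- `t`.
  have t1 : D₁ t = D₂ f - r * Q := by
    linear_combination -h12 P + e2 - e3 + a * P1 + b * P2 + b * Q1 - a * Q2 + Q * hr
  have t2 : D₂ t = -D₁ f + r * P := by
    linear_combination -h12 Q + f2 - f3 + a * Q1 + b * Q2 - b * P1 + a * P2 - P * hr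
  -- Integrability of `t`: the classical `W(K) + 2σK = -Δσ` for a conformal field with `∇W = σ I + t
  -- J`, here with `K = r`, `σ = 1 - f` and `Δf = -4r`.
  have W : r * (P * D₁ f + Q * D₂ f - (4 * f - 12)) = 0 := by
    have g1 := congrArg D₁ t2
    have g2 := congrArg D₂ t1
    simp only [map_add, map_sub, map_neg, Derivation.leibniz, smul_eq_mul] at g1 g2
    linear_combination 2 * h12 t - 2 * g1 + 2 * g2 - 2 * a * t1 - 2 * b * t2 - P * r1 - Q * r2
      + 2 * H11 + 2 * H22 - 2 * r * P1 - 2 * r * Q2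
  have W1 := transfer₁ _ W
  have W2 := transfer₂ _ W
  simp only [map_add, map_sub, Derivation.leibniz, smul_eq_mul, n1, n2, P1, P2, Q1, Q2,
    H11, H12, H21, H22] at W1 W2
  set C := D₁ f ^ 2 + D₂ f ^ 2 + 8 * r with hC
  have C1 : D₁ C = 0 := by
    simp only [hC, pow_two, map_add, Derivation.leibniz, smul_eq_mul, n1]
    linear_combination 2 * D₁ f * H11 + 2 * D₂ f * H12 + 4 * r1
  have C2 : D₂ C = 0 := by
    simp only [hC, pow_two, map_add, Derivation.leibniz, smul_eq_mul, n2]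
    linear_combination 2 * D₁ f * H21 + 2 * D₂ f * H22 + 4 * r2
  -- Pairing the gradient of `W` with that of `f` cancels `t`, which enters skew-symmetrically; `W`
  -- itself removes `P` and `Q`.
  have X : r * ((f + 3) * C - 48 * r) = 0 := by
    linear_combination -(D₁ f * W1 + D₂ f * W2) - 2 * r * W
  have X1 := transfer₁ _ X
  have X2 := transfer₂ _ X
  simp only [map_add, map_sub, Derivation.leibniz, smul_eq_mul, n1, n2, C1, C2] at X1 X2
  have Y1 : r * (D₁ f * (C - 24 * r)) = 0 := by linear_combination X1 + 24 * r * r1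
  have Y2 : r * (D₂ f * (C - 24 * r)) = 0 := by linear_combination X2 + 24 * r * r2
  have Z1 := transfer₁ _ Y1
  have Z2 := transfer₂ _ Y2
  simp only [map_sub, Derivation.leibniz, smul_eq_mul, n1, n2, C1, C2] at Z1 Z2
  -- Multiplying `Z1` by `r * D₁ f` and using `Y1` and `r1` leaves `12 (r D₁ f)³ = 0`; reducedness
  -- concludes.
  have f1 : r * D₁ f = 0 := by
    refine pow_eq_zero_iff (three_ne_zero) |>.1 (cancel 12 _ (by norm_num) ?_)
    linear_combination -r * D₁ f * Z1 + D₁ (D₁ f) * r * Y1 - 12 * r ^ 2 * D₁ f ^ 2 * r1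
  have f2 : r * D₂ f = 0 := by
    refine pow_eq_zero_iff (three_ne_zero) |>.1 (cancel 12 _ (by norm_num) ?_)
    linear_combination -r * D₂ f * Z2 + D₂ (D₂ f) * r * Y2 - 12 * r ^ 2 * D₂ f ^ 2 * r2
  have F := transfer₁ _ f1
  refine pow_eq_zero_iff two_ne_zero |>.1 (half _ ?_)
  linear_combination a * f2 - F + r * H11

end FrameAlgebra

/-! ### The ring of smooth functions on an open set and its derivations -/

section SmoothFunctions

variable {E : Type*} [NormedAddCommGroup E] [NormedSpace ℝ E]

/-- The algebra of smooth real functions on a subset of a normed space. -/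
def smoothFunctions (Ω : Set E) : Subalgebra ℝ (Ω → ℝ) where
  carrier := {f | ∃ F : E → ℝ, ContDiffOn ℝ ∞ F Ω ∧ Ω.domRestrict F = f}
  mul_mem' := by
    rintro _ _ ⟨F, hF, rfl⟩ ⟨G, hG, rfl⟩
    exact ⟨_, hF.mul hG, rfl⟩
  add_mem' := by
    rintro _ _ ⟨F, hF, rfl⟩ ⟨G, hG, rfl⟩
    exact ⟨_, hF.add hG, rfl⟩
  algebraMap_mem' := fun c => ⟨fun _ => c, contDiffOn_const, rfl⟩

/-- A smooth function on `Ω` as an element of `smoothFunctions Ω`. -/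
def smoothFunctions.mk {Ω : Set E} (F : E → ℝ) (hF : ContDiffOn ℝ ∞ F Ω) : smoothFunctions Ω :=
  ⟨Ω.domRestrict F, F, hF, rfl⟩

theorem smoothFunctions.exists_mk {Ω : Set E} (f : smoothFunctions Ω) :
    ∃ F, ∃ hF : ContDiffOn ℝ ∞ F Ω, f = smoothFunctions.mk F hF := by
  obtain ⟨_, F, hF, rfl⟩ := f
  exact ⟨F, hF, rfl⟩

/-- Inherited from real-valued functions; it is what the nilpotency argument requires. -/
instance {Ω : Set E} : IsReduced (smoothFunctions Ω) :=
  isReduced_of_injective (smoothFunctions Ω).val Subtype.val_injective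

theorem smoothFunctions.ext_on {Ω : Set E} {f g : smoothFunctions Ω}
    (h : ∀ y : Ω, (f : Ω → ℝ) y = (g : Ω → ℝ) y) : f = g :=
  Subtype.ext (funext h)

theorem contDiffOn_fderiv_apply {F : Type*} [NormedAddCommGroup F] [NormedSpace ℝ F]
    {Ω : Set E} (hΩ : IsOpen Ω) {f : E → F} (hf : ContDiffOn ℝ ∞ f Ω)
    {X : E → E} (hX : ContDiffOn ℝ ∞ X Ω) : ContDiffOn ℝ ∞ (fun y => fderiv ℝ f y (X y)) Ω :=
  (hf.fderiv_of_isOpen hΩ (by simp)).clm_apply hX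

theorem differentiableAt_of_contDiffOn {F : Type*} [NormedAddCommGroup F] [NormedSpace ℝ F]
    {Ω : Set E} (hΩ : IsOpen Ω) {f : E → F} (hf : ContDiffOn ℝ ∞ f Ω) {y : E} (hy : y ∈ Ω) :
    DifferentiableAt ℝ f y :=
  (hf.contDiffAt (hΩ.mem_nhds hy)).differentiableAt (by simp)

theorem fderiv_congr_on {F : Type*} [NormedAddCommGroup F] [NormedSpace ℝ F]
    {Ω : Set E} (hΩ : IsOpen Ω) {f g : E → F} (h : ∀ y ∈ Ω, f y = g y) {y : E} (hy : y ∈ Ω) :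
    fderiv ℝ f y = fderiv ℝ g y :=
  Filter.EventuallyEq.fderiv_eq (Filter.eventuallyEq_of_mem (hΩ.mem_nhds hy) h)

/-- The derivative of smooth functions along a smooth vector field `X`. -/
noncomputable def smoothFunctions.deriv {Ω : Set E} (hΩ : IsOpen Ω) (X : E → E) (hX : ContDiffOn ℝ ∞ X Ω)
    (f : smoothFunctions Ω) : smoothFunctions Ω :=
  smoothFunctions.mk (fun y => fderiv ℝ f.2.choose y (X y))
    (contDiffOn_fderiv_apply hΩ f.2.choose_spec.1 hX)

/-- On the open set `Ω` the derivative does not depend on the chosen extension to `E`. -/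
theorem smoothFunctions.deriv_mk {Ω : Set E} (hΩ : IsOpen Ω) (X : E → E)
    (hX : ContDiffOn ℝ ∞ X Ω) (F : E → ℝ) (hF : ContDiffOn ℝ ∞ F Ω) :
    smoothFunctions.deriv hΩ X hX (smoothFunctions.mk F hF) =
      smoothFunctions.mk (fun y => fderiv ℝ F y (X y)) (contDiffOn_fderiv_apply hΩ hF hX) := by
  refine smoothFunctions.ext_on fun y => ?_
  have h := (smoothFunctions.mk F hF).2.choose_spec.2
  exact congrArg (fun L : E →L[ℝ] ℝ => L (X y))
    (fderiv_congr_on hΩ (fun z hz => congrFun h ⟨z, hz⟩) y.2)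

/-- The derivation of the algebra of smooth functions defined by a smooth vector field. -/
noncomputable def smoothFunctions.derivation {Ω : Set E} (hΩ : IsOpen Ω) (X : E → E)
    (hX : ContDiffOn ℝ ∞ X Ω) : Derivation ℝ (smoothFunctions Ω) (smoothFunctions Ω) where
  toFun := smoothFunctions.deriv hΩ X hX
  map_add' := by
    intro f g
    obtain ⟨F, hF, rfl⟩ := smoothFunctions.exists_mk f
    obtain ⟨G, hG, rfl⟩ := smoothFunctions.exists_mk g
    rw [show smoothFunctions.mk F hF + smoothFunctions.mk G hG =
      smoothFunctions.mk (F + G) (hF.add hG) from rfl]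
    simp only [smoothFunctions.deriv_mk]
    refine smoothFunctions.ext_on fun y => ?_
    change fderiv ℝ (F + G) y (X y) = fderiv ℝ F y (X y) + fderiv ℝ G y (X y)
    rw [fderiv_add (differentiableAt_of_contDiffOn hΩ hF y.2)
      (differentiableAt_of_contDiffOn hΩ hG y.2)]
    rfl
  map_smul' := by
    intro c f
    obtain ⟨F, hF, rfl⟩ := smoothFunctions.exists_mk f
    rw [show c • smoothFunctions.mk F hF =
      smoothFunctions.mk (c • F) (contDiffOn_const.smul hF) from rfl]
    simp only [smoothFunctions.deriv_mk]
    refine smoothFunctions.ext_on fun y => ?_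
    change fderiv ℝ (c • F) y (X y) = c • fderiv ℝ F y (X y)
    rw [fderiv_const_smul (differentiableAt_of_contDiffOn hΩ hF y.2)]
    rfl
  map_one_eq_zero' := by
    refine (smoothFunctions.deriv_mk hΩ X hX (fun _ => 1) contDiffOn_const).trans ?_
    refine smoothFunctions.ext_on fun y => ?_
    change fderiv ℝ (fun _ => (1 : ℝ)) y.1 (X y) = 0
    simp
  leibniz' := by
    intro f g
    obtain ⟨F, hF, rfl⟩ := smoothFunctions.exists_mk f
    obtain ⟨G, hG, rfl⟩ := smoothFunctions.exists_mk g
    change smoothFunctions.deriv hΩ X hX (smoothFunctions.mk (F * G) (hF.mul hG)) = _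
    change _ = _ • smoothFunctions.deriv hΩ X hX _ + _ • smoothFunctions.deriv hΩ X hX _
    simp only [smoothFunctions.deriv_mk]
    refine smoothFunctions.ext_on fun y => ?_
    change fderiv ℝ (F * G) y (X y) = F y * fderiv ℝ G y (X y) + G y * fderiv ℝ F y (X y)
    rw [fderiv_mul (differentiableAt_of_contDiffOn hΩ hF y.2)
      (differentiableAt_of_contDiffOn hΩ hG y.2)]
    rfl

theorem smoothFunctions.derivation_mk {Ω : Set E} (hΩ : IsOpen Ω) (X : E → E)
    (hX : ContDiffOn ℝ ∞ X Ω) (F : E → ℝ) (hF : ContDiffOn ℝ ∞ F Ω) :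
    smoothFunctions.derivation hΩ X hX (smoothFunctions.mk F hF) =
      smoothFunctions.mk (fun y => fderiv ℝ F y (X y)) (contDiffOn_fderiv_apply hΩ hF hX) :=
  smoothFunctions.deriv_mk hΩ X hX F hF

theorem fderiv_fderiv_sub_eq_lieBracket {F : Type*} [NormedAddCommGroup F] [NormedSpace ℝ F]
    {Ω : Set E} (hΩ : IsOpen Ω) {f : E → F} (hf : ContDiffOn ℝ ∞ f Ω)
    {X Y : E → E} (hX : ContDiffOn ℝ ∞ X Ω) (hY : ContDiffOn ℝ ∞ Y Ω) {y : E} (hy : y ∈ Ω) :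
    fderiv ℝ (fun z => fderiv ℝ f z (Y z)) y (X y) - fderiv ℝ (fun z => fderiv ℝ f z (X z)) y (Y y)
      = fderiv ℝ f y (VectorField.lieBracket ℝ X Y y) := by
  have hd : DifferentiableAt ℝ (fderiv ℝ f) y :=
    differentiableAt_of_contDiffOn hΩ (hf.fderiv_of_isOpen hΩ (m := ∞) (by simp)) hy
  have hs : IsSymmSndFDerivAt ℝ f y :=
    (hf.contDiffAt (hΩ.mem_nhds hy)).isSymmSndFDerivAt (by simpa using ENat.LEInfty.out)
  rw [fderiv_clm_apply hd (differentiableAt_of_contDiffOn hΩ hX hy),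
    fderiv_clm_apply hd (differentiableAt_of_contDiffOn hΩ hY hy), VectorField.lieBracket]
  have := hs (X y) (Y y)
  simp only [_root_.add_apply, ContinuousLinearMap.comp_apply, map_sub,
    ContinuousLinearMap.flip_apply, this]
  abel

theorem derivation_bracket {Ω : Set E} (hΩ : IsOpen Ω) {X Y Z W : E → E} {s t : E → ℝ}
    (hX : ContDiffOn ℝ ∞ X Ω) (hY : ContDiffOn ℝ ∞ Y Ω) (hZ : ContDiffOn ℝ ∞ Z Ω)
    (hW : ContDiffOn ℝ ∞ W Ω) (hs : ContDiffOn ℝ ∞ s Ω) (ht : ContDiffOn ℝ ∞ t Ω)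
    (h : ∀ y ∈ Ω, VectorField.lieBracket ℝ X Y y = s y • Z y + t y • W y)
    (f : smoothFunctions Ω) :
    smoothFunctions.derivation hΩ X hX (smoothFunctions.derivation hΩ Y hY f)
      - smoothFunctions.derivation hΩ Y hY (smoothFunctions.derivation hΩ X hX f)
      = smoothFunctions.mk s hs * smoothFunctions.derivation hΩ Z hZ f
        + smoothFunctions.mk t ht * smoothFunctions.derivation hΩ W hW f := by
  obtain ⟨F, hF, rfl⟩ := smoothFunctions.exists_mk f
  simp only [smoothFunctions.derivation_mk]
  refine smoothFunctions.ext_on fun y => ?_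
  change fderiv ℝ (fun z => fderiv ℝ F z (Y z)) y (X y)
    - fderiv ℝ (fun z => fderiv ℝ F z (X z)) y (Y y)
    = s y * fderiv ℝ F y (Z y) + t y * fderiv ℝ F y (W y)
  rw [fderiv_fderiv_sub_eq_lieBracket hΩ hF hX hY y.2, h y y.2]
  simp

/-- Smooth vector fields `e₀, e₁, e₂` on an open set with the bracket relations of an adapted frame
`(ξ, e₁, φ e₁)` of a three-dimensional Kenmotsu manifold. -/
structure IsKenmotsuFrame (Ω : Set E) (e₀ e₁ e₂ : E → E) (a b c : E → ℝ) : Prop where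
  isOpen : IsOpen Ω
  smooth₀ : ContDiffOn ℝ ∞ e₀ Ω
  smooth₁ : ContDiffOn ℝ ∞ e₁ Ω
  smooth₂ : ContDiffOn ℝ ∞ e₂ Ω
  smooth_a : ContDiffOn ℝ ∞ a Ω
  smooth_b : ContDiffOn ℝ ∞ b Ω
  smooth_c : ContDiffOn ℝ ∞ c Ω
  linearIndependent : ∀ y ∈ Ω, LinearIndependent ℝ ![e₁ y, e₂ y]
  bracket₁₂ : ∀ y ∈ Ω, VectorField.lieBracket ℝ e₁ e₂ y = (-a y) • e₁ y + (-b y) • e₂ y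
  bracket₀₁ : ∀ y ∈ Ω, VectorField.lieBracket ℝ e₀ e₁ y = (-1 : ℝ) • e₁ y + c y • e₂ y
  bracket₀₂ : ∀ y ∈ Ω, VectorField.lieBracket ℝ e₀ e₂ y = (-1 : ℝ) • e₂ y + (-c y) • e₁ y

namespace IsKenmotsuFrame

variable {Ω : Set E} {e₀ e₁ e₂ : E → E} {a b c : E → ℝ}

theorem deriv_smoothFunctions (H : IsKenmotsuFrame Ω e₀ e₁ e₂ a b c) :
    ∃ D₀ D₁ D₂ : Derivation ℝ (smoothFunctions Ω) (smoothFunctions Ω),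
      (∀ F hF, D₀ (smoothFunctions.mk F hF) = smoothFunctions.mk (fun y => fderiv ℝ F y (e₀ y))
        (contDiffOn_fderiv_apply H.isOpen hF H.smooth₀)) ∧
      (∀ F hF, D₁ (smoothFunctions.mk F hF) = smoothFunctions.mk (fun y => fderiv ℝ F y (e₁ y))
        (contDiffOn_fderiv_apply H.isOpen hF H.smooth₁)) ∧
      (∀ F hF, D₂ (smoothFunctions.mk F hF) = smoothFunctions.mk (fun y => fderiv ℝ F y (e₂ y))
        (contDiffOn_fderiv_apply H.isOpen hF H.smooth₂)) ∧
      (∀ F, D₁ (D₂ F) - D₂ (D₁ F) = -smoothFunctions.mk a H.smooth_a * D₁ F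
        - smoothFunctions.mk b H.smooth_b * D₂ F) ∧
      (∀ F, D₀ (D₁ F) - D₁ (D₀ F) = -D₁ F + smoothFunctions.mk c H.smooth_c * D₂ F) ∧
      (∀ F, D₀ (D₂ F) - D₂ (D₀ F) = -D₂ F - smoothFunctions.mk c H.smooth_c * D₁ F) := by
  refine ⟨smoothFunctions.derivation H.isOpen e₀ H.smooth₀,
    smoothFunctions.derivation H.isOpen e₁ H.smooth₁,
    smoothFunctions.derivation H.isOpen e₂ H.smooth₂,
    smoothFunctions.derivation_mk _ _ _, smoothFunctions.derivation_mk _ _ _,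
    smoothFunctions.derivation_mk _ _ _, fun F => ?_, fun F => ?_, fun F => ?_⟩
  · rw [derivation_bracket H.isOpen _ _ H.smooth₁ H.smooth₂ H.smooth_a.neg H.smooth_b.neg
      H.bracket₁₂, sub_eq_add_neg, ← neg_mul]
    rfl
  · rw [derivation_bracket H.isOpen _ _ H.smooth₁ H.smooth₂ contDiffOn_const H.smooth_c
      H.bracket₀₁, ← neg_one_mul (smoothFunctions.derivation _ _ _ F)]
    rfl
  · rw [derivation_bracket H.isOpen _ _ H.smooth₂ H.smooth₁ contDiffOn_const H.smooth_c.neg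
      H.bracket₀₂, ← neg_one_mul (smoothFunctions.derivation _ _ _ F), sub_eq_add_neg, ← neg_mul]
    rfl

/-- This is the independence hypothesis of `jacobi_of_frame_brackets`: linear functionals, as test
functions, separate `e₁ y` from `e₂ y`. -/
theorem jacobi_smoothFunctions (H : IsKenmotsuFrame Ω e₀ e₁ e₂ a b c)
    {D₁ D₂ : Derivation ℝ (smoothFunctions Ω) (smoothFunctions Ω)}
    (hD₁ : ∀ F hF, D₁ (smoothFunctions.mk F hF) = smoothFunctions.mk (fun y => fderiv ℝ F y (e₁ y))
        (contDiffOn_fderiv_apply H.isOpen hF H.smooth₁))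
    (hD₂ : ∀ F hF, D₂ (smoothFunctions.mk F hF) = smoothFunctions.mk (fun y => fderiv ℝ F y (e₂ y))
        (contDiffOn_fderiv_apply H.isOpen hF H.smooth₂))
    (x z : smoothFunctions Ω) (h : ∀ F, x * D₁ F + z * D₂ F = 0) : x = 0 ∧ z = 0 := by
  have key : ∀ y : Ω, (x : Ω → ℝ) y = 0 ∧ (z : Ω → ℝ) y = 0 := fun y => by
    refine LinearIndependent.pair_iff.1 (H.linearIndependent y y.2) _ _ ?_
    refine SeparatingDual.eq_zero_of_forall_dual_eq_zero (R := ℝ) fun ℓ => ?_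
    have := h (smoothFunctions.mk ℓ ℓ.contDiff.contDiffOn)
    rw [hD₁, hD₂] at this
    have := congrFun (congrArg Subtype.val this) y
    change (x : Ω → ℝ) y * fderiv ℝ ℓ y (e₁ y) + (z : Ω → ℝ) y * fderiv ℝ ℓ y (e₂ y) = 0 at this
    simpa using this
  exact ⟨smoothFunctions.ext_on fun y => (key y).1, smoothFunctions.ext_on fun y => (key y).2⟩

theorem jacobi (H : IsKenmotsuFrame Ω e₀ e₁ e₂ a b c) {y : E} (hy : y ∈ Ω) :
    fderiv ℝ a y (e₀ y) = fderiv ℝ c y (e₁ y) - a y + b y * c y ∧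
      fderiv ℝ b y (e₀ y) = fderiv ℝ c y (e₂ y) - b y - a y * c y := by
  obtain ⟨D₀, D₁, D₂, h₀, h₁, h₂, h12, h01, h02⟩ := H.deriv_smoothFunctions
  have := jacobi_of_frame_brackets h12 h01 h02 (H.jacobi_smoothFunctions h₁ h₂)
  rw [h₀, h₀, h₁, h₂] at this
  exact ⟨congrFun (congrArg Subtype.val this.1) ⟨y, hy⟩,
    congrFun (congrArg Subtype.val this.2) ⟨y, hy⟩⟩

theorem curvature_eq_zero (H : IsKenmotsuFrame Ω e₀ e₁ e₂ a b c) {f p q : E → ℝ} (l : ℝ)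
    (hf : ContDiffOn ℝ ∞ f Ω) (hp : ContDiffOn ℝ ∞ p Ω) (hq : ContDiffOn ℝ ∞ q Ω)
    (s00 : ∀ y ∈ Ω, fderiv ℝ f y (e₀ y) + l = 0)
    (s01 : ∀ y ∈ Ω, fderiv ℝ f y (e₁ y) - p y + fderiv ℝ p y (e₀ y) - c y * q y = 0)
    (s02 : ∀ y ∈ Ω, fderiv ℝ f y (e₂ y) - q y + fderiv ℝ q y (e₀ y) + c y * p y = 0)
    (s11 : ∀ y ∈ Ω, f y + fderiv ℝ p y (e₁ y) - a y * q y
      + (fderiv ℝ a y (e₂ y) - fderiv ℝ b y (e₁ y) - a y ^ 2 - b y ^ 2 - 1) + l = 0)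
    (s22 : ∀ y ∈ Ω, f y + fderiv ℝ q y (e₂ y) + b y * p y
      + (fderiv ℝ a y (e₂ y) - fderiv ℝ b y (e₁ y) - a y ^ 2 - b y ^ 2 - 1) + l = 0)
    (s12 : ∀ y ∈ Ω, fderiv ℝ q y (e₁ y) + a y * p y + (fderiv ℝ p y (e₂ y) - b y * q y) = 0)
    {y : E} (hy : y ∈ Ω) :
    fderiv ℝ a y (e₂ y) - fderiv ℝ b y (e₁ y) - a y ^ 2 - b y ^ 2 = 0 := by
  obtain ⟨D₀, D₁, D₂, h₀, h₁, h₂, h12, h01, h02⟩ := H.deriv_smoothFunctions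
  obtain ⟨ha, hb⟩ := jacobi_of_frame_brackets h12 h01 h02 (H.jacobi_smoothFunctions h₁ h₂)
  have key := curvature_eq_zero_of_frame_equations (f := smoothFunctions.mk f hf)
    (p := smoothFunctions.mk p hp) (q := smoothFunctions.mk q hq) l h12 h01 h02 ha hb rfl
    (by rw [h₀]; exact smoothFunctions.ext_on fun y => s00 y y.2)
    (by rw [h₀, h₁]; exact smoothFunctions.ext_on fun y => s01 y y.2)
    (by rw [h₀, h₂]; exact smoothFunctions.ext_on fun y => s02 y y.2)
    (by rw [h₁, h₁, h₂]; exact smoothFunctions.ext_on fun y => s11 y y.2)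
    (by rw [h₁, h₂, h₂]; exact smoothFunctions.ext_on fun y => s22 y y.2)
    (by rw [h₁, h₂]; exact smoothFunctions.ext_on fun y => s12 y y.2)
  rw [h₁, h₂] at key
  exact congrFun (congrArg Subtype.val key) ⟨y, hy⟩

end IsKenmotsuFrame

end SmoothFunctions

/-! ### The Levi-Civita connection of a metric on a coordinate domain -/

section LeviCivita

variable {E : Type*} [NormedAddCommGroup E] [NormedSpace ℝ E]

/-- `h` is a smooth Riemannian metric on the open set `Ω`. -/
structure IsRiemannianOn (h : E → E →L[ℝ] E →L[ℝ] ℝ) (Ω : Set E) : Prop where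
  isOpen : IsOpen Ω
  smooth : ContDiffOn ℝ ∞ h Ω
  symm : ∀ y ∈ Ω, ∀ u v, h y u v = h y v u
  pos : ∀ y ∈ Ω, ∀ u, u ≠ 0 → 0 < h y u u

/-- The covariant derivative `∇_X Y` of vector fields in coordinates. -/
noncomputable def covDeriv (h : E → E →L[ℝ] E →L[ℝ] ℝ) (X Y : E → E) (y : E) : E :=
  fderiv ℝ Y y (X y) + christoffel h y (X y) (Y y)

namespace IsRiemannianOn

variable {h : E → E →L[ℝ] E →L[ℝ] ℝ} {Ω : Set E}

theorem mono (H : IsRiemannianOn h Ω) {Ω' : Set E} (hΩ' : IsOpen Ω') (hs : Ω' ⊆ Ω) :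
    IsRiemannianOn h Ω' :=
  ⟨hΩ', H.smooth.mono hs, fun y hy => H.symm y (hs hy), fun y hy => H.pos y (hs hy)⟩

theorem eq_of_forall_apply (H : IsRiemannianOn h Ω) {y : E} (hy : y ∈ Ω) {u v : E}
    (huv : ∀ w, h y u w = h y v w) : u = v := by
  by_contra hne
  have := H.pos y hy (u - v) (sub_ne_zero.2 hne)
  simp [huv] at this

theorem fderiv_symm (H : IsRiemannianOn h Ω) {y : E} (hy : y ∈ Ω) (u v w : E) :
    fderiv ℝ h y u v w = fderiv ℝ h y u w v := by
  have hd := differentiableAt_of_contDiffOn H.isOpen H.smooth hy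
  have e : ∀ v w, fderiv ℝ h y u v w = fderiv ℝ (fun z => h z v w) y u := fun v w => by
    have := ((hd.hasFDerivAt.clm_apply (hasFDerivAt_const v y)).clm_apply
      (hasFDerivAt_const w y)).fderiv
    rw [this]; simp
  rw [e, e, fderiv_congr_on H.isOpen (fun z hz => H.symm z hz v w) hy]

theorem contDiffOn_metric (H : IsRiemannianOn h Ω) {X Y : E → E} (hX : ContDiffOn ℝ ∞ X Ω)
    (hY : ContDiffOn ℝ ∞ Y Ω) : ContDiffOn ℝ ∞ (fun y => h y (X y) (Y y)) Ω :=
  (H.smooth.clm_apply hX).clm_apply hY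

/-- The Leibniz rule; it turns the pointwise Kenmotsu condition into one about vector fields. -/
theorem covDerivEndo_eq (H : IsRiemannianOn h Ω) {φ : E → E →L[ℝ] E} (hφ : ContDiffOn ℝ ∞ φ Ω)
    (X : E → E) {Y : E → E} (hY : ContDiffOn ℝ ∞ Y Ω) {y : E} (hy : y ∈ Ω) :
    covDerivEndo h φ y (X y) (Y y)
      = covDeriv h X (fun z => φ z (Y z)) y - φ y (covDeriv h X Y y) := by
  rw [covDerivEndo, covDeriv, covDeriv,
    ((differentiableAt_of_contDiffOn H.isOpen hφ hy).hasFDerivAt.clm_apply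
      (differentiableAt_of_contDiffOn H.isOpen hY hy).hasFDerivAt).fderiv]
  simp only [map_add, _root_.add_apply, ContinuousLinearMap.comp_apply,
    ContinuousLinearMap.flip_apply]
  abel

variable [FiniteDimensional ℝ E]

theorem isInvertible (H : IsRiemannianOn h Ω) {y : E} (hy : y ∈ Ω) : (h y).IsInvertible := by
  have hinj : Function.Injective (h y : E →ₗ[ℝ] (E →L[ℝ] ℝ)) := by
    intro u v huv
    exact H.eq_of_forall_apply hy fun w => congrArg (fun L : E →L[ℝ] ℝ => L w) huv
  have hfr : Module.finrank ℝ E = Module.finrank ℝ (E →L[ℝ] ℝ) := by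
    rw [← LinearMap.toContinuousLinearMap.finrank_eq]
    exact (Subspace.dual_finrank_eq (K := ℝ) (V := E)).symm
  exact ⟨(LinearEquiv.ofInjectiveOfFinrankEq (h y : E →ₗ[ℝ] (E →L[ℝ] ℝ))
    hinj hfr).toContinuousLinearEquiv, by ext; rfl⟩

theorem apply_christoffel (H : IsRiemannianOn h Ω) {y : E} (hy : y ∈ Ω) (u v w : E) :
    h y (christoffel h y u v) w = christoffelLower h y u v w := by
  obtain ⟨e, he⟩ := H.isInvertible hy
  rw [christoffel_apply, ← he, ContinuousLinearMap.inverse_equiv]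
  simp

theorem christoffel_symm (H : IsRiemannianOn h Ω) {y : E} (hy : y ∈ Ω) (u v : E) :
    christoffel h y u v = christoffel h y v u := by
  refine H.eq_of_forall_apply hy fun w => ?_
  rw [H.apply_christoffel hy, H.apply_christoffel hy, christoffelLower_apply,
    christoffelLower_apply, H.fderiv_symm hy w u v]
  ring

theorem fderiv_metric (H : IsRiemannianOn h Ω) {y : E} (hy : y ∈ Ω) (u v w : E) :
    fderiv ℝ h y u v w = h y (christoffel h y u v) w + h y v (christoffel h y u w) := by
  rw [H.symm y hy v, H.apply_christoffel hy, H.apply_christoffel hy,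
    christoffelLower_apply, christoffelLower_apply, H.fderiv_symm hy u w v]
  ring

theorem contDiffOn_christoffel (H : IsRiemannianOn h Ω) : ContDiffOn ℝ ∞ (christoffel h) Ω := by
  have hD : ContDiffOn ℝ ∞ (fderiv ℝ h) Ω := H.smooth.fderiv_of_isOpen H.isOpen (by simp)
  have hflip : ContDiffOn ℝ ∞ (fun y => (fderiv ℝ h y).flip) Ω :=
    (ContinuousLinearMap.flipₗᵢ ℝ E E (E →L[ℝ] ℝ)).contDiff.comp_contDiffOn hD
  have hlow : ContDiffOn ℝ ∞ (christoffelLower h) Ω :=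
    ((hD.add hflip).sub ((contDiffOn_const (c := (ContinuousLinearMap.flipₗᵢ ℝ E E ℝ :
      (E →L[ℝ] E →L[ℝ] ℝ) →L[ℝ] E →L[ℝ] E →L[ℝ] ℝ))).clm_comp hflip)).const_smul (1 / 2 : ℝ)
  -- Inversion of operators is smooth at invertible ones, and positivity makes `h y` invertible in
  -- finite dimension.
  have hinv : ContDiffOn ℝ ∞ (fun y => (h y).inverse) Ω := fun y hy => by
    have : ContDiffAt ℝ ∞ ContinuousLinearMap.inverse (h y) := by
      obtain ⟨e, he⟩ := H.isInvertible hy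
      rw [← he]
      exact contDiffAt_map_inverse e
    exact this.comp_contDiffWithinAt y (H.smooth y hy)
  exact ((ContinuousLinearMap.compL ℝ E (E →L[ℝ] ℝ) E).contDiff.comp_contDiffOn hinv).clm_comp hlow

theorem contDiffOn_covDeriv (H : IsRiemannianOn h Ω) {X Y : E → E} (hX : ContDiffOn ℝ ∞ X Ω)
    (hY : ContDiffOn ℝ ∞ Y Ω) : ContDiffOn ℝ ∞ (covDeriv h X Y) Ω :=
  (contDiffOn_fderiv_apply H.isOpen hY hX).add ((H.contDiffOn_christoffel.clm_apply hX).clm_apply hY)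

/-- The connection is metric. -/
theorem fderiv_metric_apply (H : IsRiemannianOn h Ω) {Y Z : E → E}
    (hY : ContDiffOn ℝ ∞ Y Ω) (hZ : ContDiffOn ℝ ∞ Z Ω) (X : E → E) {y : E} (hy : y ∈ Ω) :
    fderiv ℝ (fun z => h z (Y z) (Z z)) y (X y)
      = h y (covDeriv h X Y y) (Z y) + h y (Y y) (covDeriv h X Z y) := by
  have hd := differentiableAt_of_contDiffOn H.isOpen H.smooth hy
  have hYd := differentiableAt_of_contDiffOn H.isOpen hY hy
  have hZd := differentiableAt_of_contDiffOn H.isOpen hZ hy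
  rw [((hd.hasFDerivAt.clm_apply hYd.hasFDerivAt).clm_apply hZd.hasFDerivAt).fderiv]
  simp only [covDeriv, map_add, _root_.add_apply, ContinuousLinearMap.comp_apply,
    ContinuousLinearMap.flip_apply, H.fderiv_metric hy]
  ring

/-- The connection is torsion-free. -/
theorem lieBracket_eq (H : IsRiemannianOn h Ω) (X Y : E → E) {y : E} (hy : y ∈ Ω) :
    VectorField.lieBracket ℝ X Y y = covDeriv h X Y y - covDeriv h Y X y := by
  rw [covDeriv, covDeriv, H.christoffel_symm hy (Y y), VectorField.lieBracket]
  abel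

/-- Metric compatibility turns `D_V h` into Christoffel terms, and symmetry of `Γ` absorbs them into
`∇V`. -/
theorem lieDerivMetric_eq (H : IsRiemannianOn h Ω) (V X Y : E → E) {y : E} (hy : y ∈ Ω) :
    lieDerivMetric h V y (X y) (Y y)
      = h y (covDeriv h X V y) (Y y) + h y (X y) (covDeriv h Y V y) := by
  rw [lieDerivMetric, H.fderiv_metric hy, covDeriv, covDeriv, H.christoffel_symm hy (X y),
    H.christoffel_symm hy (Y y)]
  simp only [map_add, _root_.add_apply]
  ring

/-- The curvature operator is the commutator of covariant derivatives. -/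
theorem curvature_eq (H : IsRiemannianOn h Ω) {X Y Z : E → E} (hX : ContDiffOn ℝ ∞ X Ω)
    (hY : ContDiffOn ℝ ∞ Y Ω) (hZ : ContDiffOn ℝ ∞ Z Ω) {y : E} (hy : y ∈ Ω) :
    curvature h y (X y) (Y y) (Z y)
      = covDeriv h X (covDeriv h Y Z) y - covDeriv h Y (covDeriv h X Z) y
        - covDeriv h (VectorField.lieBracket ℝ X Y) Z y := by
  have hXd := (differentiableAt_of_contDiffOn H.isOpen hX hy).hasFDerivAt
  have hYd := (differentiableAt_of_contDiffOn H.isOpen hY hy).hasFDerivAt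
  have hZd := (differentiableAt_of_contDiffOn H.isOpen hZ hy).hasFDerivAt
  have hΓ := (differentiableAt_of_contDiffOn H.isOpen H.contDiffOn_christoffel hy).hasFDerivAt
  have hFd : ∀ {W : E → E}, ContDiffOn ℝ ∞ W Ω →
      DifferentiableAt ℝ (fun z => fderiv ℝ Z z (W z)) y := fun hW =>
    differentiableAt_of_contDiffOn H.isOpen (contDiffOn_fderiv_apply H.isOpen hZ hW) hy
  have key : ∀ {W U : E → E} {W' : E →L[ℝ] E}, ContDiffOn ℝ ∞ W Ω → HasFDerivAt W W' y →
      covDeriv h U (covDeriv h W Z) y = fderiv ℝ (fun z => fderiv ℝ Z z (W z)) y (U y)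
        + (fderiv ℝ (christoffel h) y (U y) (W y) (Z y) + christoffel h y (W' (U y)) (Z y)
          + christoffel h y (W y) (fderiv ℝ Z y (U y)))
        + (christoffel h y (U y) (fderiv ℝ Z y (W y))
          + christoffel h y (U y) (christoffel h y (W y) (Z y))) := fun hW hW' => by
    have := ((hFd hW).hasFDerivAt.add ((hΓ.clm_apply hW').clm_apply hZd)).fderiv
    rw [covDeriv, show covDeriv h _ Z = fun z => fderiv ℝ Z z _ + christoffel h z _ (Z z) from rfl]
    erw [this]
    simp only [map_add, _root_.add_apply, ContinuousLinearMap.comp_apply,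
      ContinuousLinearMap.flip_apply]
    abel
  -- The second derivatives of `Z` leave only its derivative along the bracket.
  have hb := fderiv_fderiv_sub_eq_lieBracket H.isOpen hZ hX hY hy
  rw [key hY hYd, key hX hXd, sub_eq_iff_eq_add.1 hb, covDeriv, curvature, VectorField.lieBracket]
  simp only [map_sub, _root_.add_apply, _root_.sub_apply, ContinuousLinearMap.comp_apply]
  abel

end IsRiemannianOn

end LeviCivita

/-! ### Orthonormal frames -/

section Frames

variable {E : Type*} [NormedAddCommGroup E] [NormedSpace ℝ E]
  {h : E → E →L[ℝ] E →L[ℝ] ℝ} {Ω : Set E}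

theorem covDeriv_congr {X X' Y Y' : E → E} (hΩ : IsOpen Ω) (hY : ∀ z ∈ Ω, Y z = Y' z) {y : E}
    (hy : y ∈ Ω) (hX : X y = X' y) : covDeriv h X Y y = covDeriv h X' Y' y := by
  rw [covDeriv, covDeriv, hX, fderiv_congr_on hΩ hY hy, hY y hy]

theorem covDeriv_sum_smul_left {ι : Type*} (s : Finset ι) (c : ι → ℝ) (u : ι → E → E) (X Y : E → E)
    {y : E} (hX : X y = ∑ i ∈ s, c i • u i y) :
    covDeriv h X Y y = ∑ i ∈ s, c i • covDeriv h (u i) Y y := by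
  simp only [covDeriv, hX, map_sum, map_smul, sum_apply, smul_apply, smul_add,
    Finset.sum_add_distrib]

theorem covDeriv_sum_smul_right {ι : Type*} (hΩ : IsOpen Ω) (s : Finset ι) (c : ι → E → ℝ)
    (u : ι → E → E) (hc : ∀ i, ContDiffOn ℝ ∞ (c i) Ω) (hu : ∀ i, ContDiffOn ℝ ∞ (u i) Ω)
    (X Y : E → E) (hY : ∀ z ∈ Ω, Y z = ∑ i ∈ s, c i z • u i z) {y : E} (hy : y ∈ Ω) :
    covDeriv h X Y y
      = ∑ i ∈ s, (fderiv ℝ (c i) y (X y) • u i y + c i y • covDeriv h X (u i) y) := by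
  have hd : HasFDerivAt (fun z => ∑ i ∈ s, c i z • u i z)
      (∑ i ∈ s, (c i y • fderiv ℝ (u i) y + (fderiv ℝ (c i) y).smulRight (u i y))) y :=
    HasFDerivAt.fun_sum fun i _ =>
      (differentiableAt_of_contDiffOn hΩ (hc i) hy).hasFDerivAt.smul
        (differentiableAt_of_contDiffOn hΩ (hu i) hy).hasFDerivAt
  rw [covDeriv_congr hΩ hY hy rfl, covDeriv, hd.fderiv]
  simp only [covDeriv, map_sum, map_smul, sum_apply, smul_apply, smul_add, _root_.add_apply,
    ContinuousLinearMap.smulRight_apply, ← Finset.sum_add_distrib]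
  exact Finset.sum_congr rfl fun i _ => by abel

theorem IsRiemannianOn.lieBracket_eq_sum [FiniteDimensional ℝ E] {e : Fin 3 → E → E} (H : IsRiemannianOn h Ω)
    {G : Fin 3 → Fin 3 → Fin 3 → E → ℝ}
    (hG : ∀ y ∈ Ω, ∀ i j, covDeriv h (e i) (e j) y = ∑ k, G i j k y • e k y)
    {y : E} (hy : y ∈ Ω) (i j : Fin 3) :
    VectorField.lieBracket ℝ (e i) (e j) y = ∑ k, (G i j k y - G j i k y) • e k y := by
  rw [H.lieBracket_eq _ _ hy, hG y hy, hG y hy, ← Finset.sum_sub_distrib]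
  simp only [sub_smul]

/-- `e` is a smooth orthonormal frame on `Ω` for the metric `h`. -/
structure IsOrthonormalFrame (h : E → E →L[ℝ] E →L[ℝ] ℝ) (Ω : Set E) (e : Fin 3 → E → E) :
    Prop where
  smooth : ∀ i, ContDiffOn ℝ ∞ (e i) Ω
  orthonormal : ∀ y ∈ Ω, ∀ i j, h y (e i y) (e j y) = if i = j then 1 else 0

namespace IsOrthonormalFrame

variable {e : Fin 3 → E → E}

theorem linearIndependent (F : IsOrthonormalFrame h Ω e) {y : E} (hy : y ∈ Ω) :
    LinearIndependent ℝ (fun i => e i y) := by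
  rw [Fintype.linearIndependent_iff]
  intro g hg i
  have := congrArg (fun u => h y u (e i y)) hg
  simpa [F.orthonormal y hy, sum_apply] using this

theorem exists_basis (F : IsOrthonormalFrame h Ω e) (hE : Module.finrank ℝ E = 3) {y : E}
    (hy : y ∈ Ω) :
    ∃ b : Module.Basis (Fin 3) ℝ E, (∀ i, b i = e i y) ∧ ∀ u i, b.repr u i = h y u (e i y) := by
  have hb : ∀ i, basisOfLinearIndependentOfCardEqFinrank (F.linearIndependent hy)
    (by simp [hE]) i = e i y := fun i => by simp
  refine ⟨_, hb, fun u i => ?_⟩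
  generalize basisOfLinearIndependentOfCardEqFinrank (F.linearIndependent hy) (by simp [hE]) = b
    at hb
  conv_rhs => rw [← b.sum_repr u]
  simp [hb, F.orthonormal y hy, sum_apply]

theorem eq_sum (F : IsOrthonormalFrame h Ω e) (hE : Module.finrank ℝ E = 3) {y : E}
    (hy : y ∈ Ω) (u : E) : u = ∑ i, h y u (e i y) • e i y := by
  obtain ⟨b, hb, hr⟩ := F.exists_basis hE hy
  conv_lhs => rw [← b.sum_repr u]
  simp [hb, hr]

theorem trace_eq (F : IsOrthonormalFrame h Ω e) (hE : Module.finrank ℝ E = 3) {y : E}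
    (hy : y ∈ Ω) (T : E →L[ℝ] E) : LinearMap.trace ℝ E T = ∑ i, h y (T (e i y)) (e i y) := by
  obtain ⟨b, hb, hr⟩ := F.exists_basis hE hy
  rw [LinearMap.trace_eq_matrix_trace ℝ b, Matrix.trace]
  simp [LinearMap.toMatrix_apply, hb, hr]

variable [FiniteDimensional ℝ E]

/-- Components of the curvature tensor in terms of the connection coefficients of a frame. -/
theorem curvature_component (F : IsOrthonormalFrame h Ω e) (H : IsRiemannianOn h Ω)
    {G : Fin 3 → Fin 3 → Fin 3 → E → ℝ} (hGs : ∀ i j k, ContDiffOn ℝ ∞ (G i j k) Ω)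
    (hG : ∀ y ∈ Ω, ∀ i j, covDeriv h (e i) (e j) y = ∑ k, G i j k y • e k y)
    {y : E} (hy : y ∈ Ω) (i j k l : Fin 3) :
    h y (curvature h y (e i y) (e j y) (e k y)) (e l y)
      = fderiv ℝ (G j k l) y (e i y) - fderiv ℝ (G i k l) y (e j y)
        + ∑ m, (G j k m y * G i m l y - G i k m y * G j m l y
          - (G i j m y - G j i m y) * G m k l y) := by
  have h1 : ∀ i j, covDeriv h (e i) (covDeriv h (e j) (e k)) y =
      ∑ m, (fderiv ℝ (G j k m) y (e i y) • e m y + G j k m y • ∑ l, G i m l y • e l y) :=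
    fun i j => by
      rw [covDeriv_sum_smul_right H.isOpen Finset.univ (G j k) e (hGs j k) F.smooth _ _
        (fun z hz => hG z hz j k) hy]
      simp only [hG y hy]
  rw [H.curvature_eq (F.smooth i) (F.smooth j) (F.smooth k) hy, h1, h1,
    covDeriv_sum_smul_left Finset.univ _ _ _ _ (H.lieBracket_eq_sum hG hy i j)]
  simp only [hG y hy, map_sub, map_sum, map_add, map_smul, sum_apply, _root_.sub_apply,
    _root_.add_apply, smul_apply, smul_eq_mul, F.orthonormal y hy, mul_ite, mul_one, mul_zero,
    Finset.sum_ite_eq', Finset.mem_univ, if_true, Finset.sum_add_distrib, Finset.sum_sub_distrib]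
  ring

end IsOrthonormalFrame

end Frames

/-! ### Kenmotsu structures on a coordinate domain -/

section KenmotsuCoordinates

variable {E : Type*} [NormedAddCommGroup E] [NormedSpace ℝ E]

/-- `(φ, ξ, η, h)` is a Kenmotsu structure on the open set `Ω`. -/
structure IsKenmotsuOn (h : E → E →L[ℝ] E →L[ℝ] ℝ) (φ : E → E →L[ℝ] E) (ξ : E → E)
    (η : E → E →L[ℝ] ℝ) (Ω : Set E) : Prop extends IsRiemannianOn h Ω where
  smooth_φ : ContDiffOn ℝ ∞ φ Ω
  smooth_ξ : ContDiffOn ℝ ∞ ξ Ω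
  φ_φ : ∀ y ∈ Ω, ∀ u, φ y (φ y u) = -u + η y u • ξ y
  η_ξ : ∀ y ∈ Ω, η y (ξ y) = 1
  h_φ_φ : ∀ y ∈ Ω, ∀ u v, h y (φ y u) (φ y v) = h y u v - η y u * η y v
  covDerivEndo_eq' : ∀ y ∈ Ω, ∀ u v,
    covDerivEndo h φ y u v = h y (φ y u) v • ξ y - η y v • φ y u

namespace IsKenmotsuOn

variable {h : E → E →L[ℝ] E →L[ℝ] ℝ} {φ : E → E →L[ℝ] E} {ξ : E → E} {η : E → E →L[ℝ] ℝ}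
  {Ω : Set E} {y : E}

theorem restrict (K : IsKenmotsuOn h φ ξ η Ω) {Ω' : Set E} (hΩ' : IsOpen Ω') (hs : Ω' ⊆ Ω) :
    IsKenmotsuOn h φ ξ η Ω' where
  toIsRiemannianOn := K.toIsRiemannianOn.mono hΩ' hs
  smooth_φ := K.smooth_φ.mono hs
  smooth_ξ := K.smooth_ξ.mono hs
  φ_φ y hy := K.φ_φ y (hs hy)
  η_ξ y hy := K.η_ξ y (hs hy)
  h_φ_φ y hy := K.h_φ_φ y (hs hy)
  covDerivEndo_eq' y hy := K.covDerivEndo_eq' y (hs hy)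

theorem φ_ξ (K : IsKenmotsuOn h φ ξ η Ω) (hy : y ∈ Ω) : φ y (ξ y) = 0 := by
  have h1 : φ y (φ y (ξ y)) = 0 := by rw [K.φ_φ y hy, K.η_ξ y hy, one_smul, neg_add_cancel]
  have h2 := K.φ_φ y hy (φ y (ξ y))
  rw [h1, map_zero] at h2
  have h3 : φ y (ξ y) = η y (φ y (ξ y)) • ξ y := by
    rw [eq_comm, neg_add_eq_zero] at h2; exact h2
  have h4 : η y (φ y (ξ y)) * η y (φ y (ξ y)) = 0 := by
    have := h1
    rw [h3, map_smul, h3, ← mul_smul] at this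
    have := congrArg (η y) this
    simpa [K.η_ξ y hy] using this
  rw [h3, mul_self_eq_zero.1 h4, zero_smul]

/-- Computing `φ³ u` in two ways leaves `η(φ u) ξ = 0`. -/
theorem η_φ (K : IsKenmotsuOn h φ ξ η Ω) (hy : y ∈ Ω) (u : E) : η y (φ y u) = 0 := by
  have h1 := K.φ_φ y hy (φ y u)
  rw [K.φ_φ y hy u, map_add, map_neg, map_smul, K.φ_ξ hy, smul_zero, add_zero,
    left_eq_add] at h1
  have := congrArg (η y) h1
  simpa [K.η_ξ y hy] using this

theorem h_ξ (K : IsKenmotsuOn h φ ξ η Ω) (hy : y ∈ Ω) (u : E) : h y u (ξ y) = η y u := by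
  have := K.h_φ_φ y hy u (ξ y)
  rw [K.φ_ξ hy, map_zero, K.η_ξ y hy] at this
  linarith

theorem h_φ_left (K : IsKenmotsuOn h φ ξ η Ω) (hy : y ∈ Ω) (u v : E) :
    h y (φ y u) v = -h y u (φ y v) := by
  have := K.h_φ_φ y hy u (φ y v)
  rw [K.φ_φ y hy, K.η_φ hy, map_add, map_neg, map_smul, K.h_ξ hy, K.η_φ hy] at this
  simp only [smul_eq_mul] at this
  linarith

variable [FiniteDimensional ℝ E]

/-- On a Kenmotsu manifold, `∇_X ξ = X - η(X) ξ`. -/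
theorem covDeriv_ξ (K : IsKenmotsuOn h φ ξ η Ω) (hy : y ∈ Ω) (X : E → E) :
    covDeriv h X ξ y = X y - η y (X y) • ξ y := by
  -- Differentiating `φ ξ = 0` gives `φ (∇_X ξ) = φ X`. As `ξ` has unit length, `∇_X ξ` is
  -- orthogonal to `ξ`, so a second `φ` recovers it.
  have h1 : covDeriv h X (fun z => φ z (ξ z)) y = 0 := by
    rw [covDeriv_congr (Y' := fun _ => 0) K.isOpen (fun z hz => K.φ_ξ hz) hy rfl, covDeriv]
    simp
  have h2 := K.covDerivEndo_eq K.smooth_φ X K.smooth_ξ hy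
  rw [K.covDerivEndo_eq' y hy, h1, K.η_ξ y hy, K.h_ξ hy, K.η_φ hy, zero_smul, zero_sub, zero_sub,
    one_smul, neg_inj] at h2
  have h3 : η y (covDeriv h X ξ y) = 0 := by
    have := K.fderiv_metric_apply K.smooth_ξ K.smooth_ξ X hy
    rw [fderiv_congr_on (g := fun _ => 1) K.isOpen (fun z hz => by rw [K.h_ξ hz, K.η_ξ z hz]) hy,
      K.symm y hy (ξ y), K.h_ξ hy] at this
    simp at this
    linarith
  have h4 := congrArg (φ y) h2
  rw [K.φ_φ y hy, K.φ_φ y hy, h3, zero_smul, add_zero] at h4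
  rw [← neg_inj, ← h4]
  abel

end IsKenmotsuOn

/-- An orthonormal frame of the form `(ξ, e₁, φ e₁)`. -/
structure IsAdaptedFrame (h : E → E →L[ℝ] E →L[ℝ] ℝ) (φ : E → E →L[ℝ] E) (ξ : E → E)
    (Ω : Set E) (e : Fin 3 → E → E) : Prop extends IsOrthonormalFrame h Ω e where
  frame_zero : e 0 = ξ
  φ_one : ∀ y ∈ Ω, φ y (e 1 y) = e 2 y
  φ_two : ∀ y ∈ Ω, φ y (e 2 y) = -e 1 y

/-- Normalise `φ w` for a fixed `w` wherever it is nonzero: being in the image of `φ` it is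
automatically orthogonal to `ξ`. Such a `w` exists, since `φ = 0` at `x` would make `ξ` span the
space. -/
theorem IsKenmotsuOn.exists_adaptedFrame {h : E → E →L[ℝ] E →L[ℝ] ℝ} {φ : E → E →L[ℝ] E} {ξ : E → E}
    {η : E → E →L[ℝ] ℝ} {Ω : Set E} (K : IsKenmotsuOn h φ ξ η Ω) (hE : Module.finrank ℝ E = 3)
    {x : E} (hx : x ∈ Ω) :
    ∃ Ω' ⊆ Ω, x ∈ Ω' ∧ IsOpen Ω' ∧ ∃ e, IsAdaptedFrame h φ ξ Ω' e := by
  obtain ⟨w, hw⟩ : ∃ w, φ x w ≠ 0 := by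
    by_contra! hφ
    have hspan : ∀ w, w = η x w • ξ x := fun w => by
      have := K.φ_φ x hx w
      rw [hφ, eq_comm, neg_add_eq_zero] at this
      exact this
    have : Module.finrank ℝ E ≤ 1 := finrank_le_one (ξ x) fun w => ⟨η x w, (hspan w).symm⟩
    omega
  set N : E → ℝ := fun y => h y (φ y w) (φ y w) with hN
  have hφw : ContDiffOn ℝ ∞ (fun y => φ y w) Ω := K.smooth_φ.clm_apply contDiffOn_const
  have hNs : ContDiffOn ℝ ∞ N Ω := K.contDiffOn_metric hφw hφw
  have hsub : Ω ∩ N ⁻¹' Set.Ioi 0 ⊆ Ω := Set.inter_subset_left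
  have hop : IsOpen (Ω ∩ N ⁻¹' Set.Ioi 0) :=
    hNs.continuousOn.isOpen_inter_preimage K.isOpen isOpen_Ioi
  have hsq : ContDiffOn ℝ ∞ (fun y => (√(N y))⁻¹) (Ω ∩ N ⁻¹' Set.Ioi 0) :=
    ((hNs.mono hsub).sqrt fun y hy => (Set.mem_Ioi.1 hy.2).ne').inv
      fun y hy => (Real.sqrt_pos.2 hy.2).ne'
  have he1 : ContDiffOn ℝ ∞ (fun y => (√(N y))⁻¹ • φ y w) (Ω ∩ N ⁻¹' Set.Ioi 0) :=
    hsq.smul (hφw.mono hsub)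
  have he2 : ContDiffOn ℝ ∞ (fun y => φ y ((√(N y))⁻¹ • φ y w)) (Ω ∩ N ⁻¹' Set.Ioi 0) :=
    (K.smooth_φ.mono hsub).clm_apply he1
  have hη : ∀ y ∈ Ω, η y ((√(N y))⁻¹ • φ y w) = 0 := fun y hy => by
    rw [map_smul, K.η_φ hy, smul_zero]
  have h11 : ∀ y ∈ Ω ∩ N ⁻¹' Set.Ioi 0, h y ((√(N y))⁻¹ • φ y w) ((√(N y))⁻¹ • φ y w) = 1 :=
    fun y hy => by
      have hpos : 0 < N y := hy.2
      have : (√(N y))⁻¹ * ((√(N y))⁻¹ * N y) = 1 := by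
        rw [← mul_assoc, ← mul_inv, Real.mul_self_sqrt hpos.le, inv_mul_cancel₀ hpos.ne']
      simpa using this
  have h12 : ∀ y ∈ Ω, ∀ u, h y u (φ y u) = 0 := fun y hy u => by
    have := K.h_φ_left hy u u
    rw [K.symm y hy] at this
    linarith
  refine ⟨Ω ∩ N ⁻¹' Set.Ioi 0, hsub, ⟨hx, K.pos x hx _ hw⟩, hop,
    ![ξ, fun y => (√(N y))⁻¹ • φ y w, fun y => φ y ((√(N y))⁻¹ • φ y w)], ?_⟩
  refine { smooth := ?_, orthonormal := ?_, frame_zero := rfl, φ_one := fun y hy => rfl,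
           φ_two := ?_ }
  · intro i
    fin_cases i
    exacts [K.smooth_ξ.mono hsub, he1, he2]
  · intro y hy i j
    have hyΩ := hsub hy
    fin_cases i <;> fin_cases j
    · exact (K.h_ξ hyΩ _).trans (K.η_ξ y hyΩ)
    · exact (K.symm y hyΩ _ _).trans ((K.h_ξ hyΩ _).trans (hη y hyΩ))
    · exact (K.symm y hyΩ _ _).trans ((K.h_ξ hyΩ _).trans (K.η_φ hyΩ _))
    · exact (K.h_ξ hyΩ _).trans (hη y hyΩ)
    · exact h11 y hy
    · exact h12 y hyΩ _
    · exact (K.h_ξ hyΩ _).trans (K.η_φ hyΩ _)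
    · exact (K.symm y hyΩ _ _).trans (h12 y hyΩ _)
    · refine (K.h_φ_φ y hyΩ _ _).trans ?_
      rw [hη y hyΩ, mul_zero, sub_zero]
      exact h11 y hy
  · intro y hy
    refine (K.φ_φ y (hsub hy) _).trans ?_
    rw [hη y (hsub hy), zero_smul, add_zero]
    rfl

end KenmotsuCoordinates

/-! ### Connection and curvature in an adapted frame -/

section AdaptedFrame

/-- Connection coefficients `g(∇_{eᵢ} eⱼ, eₖ)` of an adapted frame on a three-dimensional Kenmotsu
manifold, where `w = g(∇_{eᵢ} e₁, e₂)`. -/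
def frameConnection (w : ℝ) (i : Fin 3) : Fin 3 → Fin 3 → ℝ :=
  ![![0, if i = 1 then 1 else 0, if i = 2 then 1 else 0],
    ![if i = 1 then -1 else 0, 0, w],
    ![if i = 2 then -1 else 0, -w, 0]]

/-- The volume form of the contact planes in an adapted frame. -/
def contactArea : Fin 3 → Fin 3 → ℝ := ![![0, 0, 0], ![0, 0, 1], ![0, -1, 0]]

variable {E : Type*} [NormedAddCommGroup E] [NormedSpace ℝ E] [FiniteDimensional ℝ E]
  {h : E → E →L[ℝ] E →L[ℝ] ℝ} {φ : E → E →L[ℝ] E} {ξ : E → E} {η : E → E →L[ℝ] ℝ} {Ω : Set E}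
  {e : Fin 3 → E → E}

theorem IsRiemannianOn.frame_skew (H : IsRiemannianOn h Ω) (F : IsOrthonormalFrame h Ω e)
    (X : E → E) {y : E} (hy : y ∈ Ω) (j k : Fin 3) :
    h y (covDeriv h X (e j) y) (e k y) = -h y (covDeriv h X (e k) y) (e j y) := by
  have := H.fderiv_metric_apply (F.smooth j) (F.smooth k) X hy
  rw [fderiv_congr_on (g := fun _ => if j = k then (1 : ℝ) else 0) H.isOpen
    (fun z hz => F.orthonormal z hz j k) hy, H.symm y hy (e j y)] at this
  simp only [fderiv_fun_const, Pi.zero_apply, _root_.zero_apply] at this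
  linarith

/-- The connection form `g(∇_{eᵢ} e₁, e₂)` of a frame. -/
noncomputable def connectionForm (h : E → E →L[ℝ] E →L[ℝ] ℝ) (e : Fin 3 → E → E) (i : Fin 3)
    (y : E) : ℝ :=
  h y (covDeriv h (e i) (e 1) y) (e 2 y)

namespace IsAdaptedFrame

theorem contDiffOn_connectionForm (A : IsAdaptedFrame h φ ξ Ω e) (K : IsRiemannianOn h Ω)
    (i : Fin 3) : ContDiffOn ℝ ∞ (connectionForm h e i) Ω :=
  K.contDiffOn_metric (K.contDiffOn_covDeriv (A.smooth i) (A.smooth 1)) (A.smooth 2)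

theorem contDiffOn_frameConnection (A : IsAdaptedFrame h φ ξ Ω e) (K : IsRiemannianOn h Ω)
    (i j k : Fin 3) :
    ContDiffOn ℝ ∞ (fun y => frameConnection (connectionForm h e i y) i j k) Ω := by
  have hw := A.contDiffOn_connectionForm K i
  fin_cases j <;> fin_cases k <;>
    simp only [frameConnection, Fin.isValue, Fin.zero_eta, Fin.mk_one, Fin.reduceFinMk,
      Matrix.cons_val] <;>
    first | exact contDiffOn_const | exact hw | exact hw.neg

omit [FiniteDimensional ℝ E] in
theorem η_frame (A : IsAdaptedFrame h φ ξ Ω e) (K : IsKenmotsuOn h φ ξ η Ω) {y : E} (hy : y ∈ Ω)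
    (i : Fin 3) : η y (e i y) = if i = 0 then 1 else 0 := by
  rw [← K.h_ξ hy, ← A.frame_zero]
  exact A.orthonormal y hy i 0

/-- The formula for `∇ξ` fixes the coefficients involving `e₀`; skew-symmetry leaves one unknown for
each direction. -/
theorem covDeriv_frame (A : IsAdaptedFrame h φ ξ Ω e) (K : IsKenmotsuOn h φ ξ η Ω)
    (hE : Module.finrank ℝ E = 3) {y : E} (hy : y ∈ Ω) (i j : Fin 3) :
    covDeriv h (e i) (e j) y = ∑ k, frameConnection (connectionForm h e i y) i j k • e k y := by
  have h0 : ∀ k, h y (covDeriv h (e i) (e 0) y) (e k y)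
      = (if i = k then 1 else 0) - (if i = 0 then 1 else 0) * (if 0 = k then 1 else 0) := fun k => by
    have := K.covDeriv_ξ hy (e i)
    rw [← A.frame_zero, A.η_frame K hy] at this
    rw [this, map_sub, map_smul, _root_.sub_apply, smul_apply, A.orthonormal y hy,
      A.orthonormal y hy, smul_eq_mul]
  have hs := K.frame_skew A.toIsOrthonormalFrame (e i) hy
  rw [A.eq_sum hE hy (covDeriv h (e i) (e j) y)]
  refine Finset.sum_congr rfl fun k _ => ?_
  congr 1
  have hsk : ∀ j, h y (covDeriv h (e i) (e j) y) (e j y) = 0 := fun j => by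
    have := hs j j
    linarith
  have h12 : h y (covDeriv h (e i) (e 1) y) (e 2 y) = connectionForm h e i y := rfl
  have h21 := hs 2 1
  rw [h12] at h21
  fin_cases j
  · refine (h0 k).trans ?_
    fin_cases k <;> fin_cases i <;> simp [frameConnection]
  · fin_cases k
    · refine (hs 1 0).trans ?_
      rw [h0]
      fin_cases i <;> simp [frameConnection]
    · exact hsk 1
    · exact h12
  · fin_cases k
    · refine (hs 2 0).trans ?_
      rw [h0]
      fin_cases i <;> simp [frameConnection]
    · exact h21
    · exact hsk 2

theorem isKenmotsuFrame (A : IsAdaptedFrame h φ ξ Ω e) (K : IsKenmotsuOn h φ ξ η Ω)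
    (hE : Module.finrank ℝ E = 3) :
    IsKenmotsuFrame Ω (e 0) (e 1) (e 2) (connectionForm h e 1) (connectionForm h e 2)
      (connectionForm h e 0) where
  isOpen := K.isOpen
  smooth₀ := A.smooth 0
  smooth₁ := A.smooth 1
  smooth₂ := A.smooth 2
  smooth_a := A.contDiffOn_connectionForm K.toIsRiemannianOn 1
  smooth_b := A.contDiffOn_connectionForm K.toIsRiemannianOn 2
  smooth_c := A.contDiffOn_connectionForm K.toIsRiemannianOn 0
  linearIndependent y hy := by
    have := (A.linearIndependent hy).comp ![(1 : Fin 3), 2] (by decide)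
    convert this using 1
    ext i; fin_cases i <;> rfl
  bracket₁₂ y hy := by
    rw [K.lieBracket_eq _ _ hy, A.covDeriv_frame K hE hy, A.covDeriv_frame K hE hy]
    simp [Fin.sum_univ_three, frameConnection]
    abel
  bracket₀₁ y hy := by
    rw [K.lieBracket_eq _ _ hy, A.covDeriv_frame K hE hy, A.covDeriv_frame K hE hy]
    simp [Fin.sum_univ_three, frameConnection]
    abel
  bracket₀₂ y hy := by
    rw [K.lieBracket_eq _ _ hy, A.covDeriv_frame K hE hy, A.covDeriv_frame K hE hy]
    simp [Fin.sum_univ_three, frameConnection]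
    abel

/-- The deviation of the curvature of the contact planes from `-1`. -/
noncomputable def _root_.KenmotsuGeometry.curvatureExcess (h : E → E →L[ℝ] E →L[ℝ] ℝ)
    (e : Fin 3 → E → E) (y : E) : ℝ :=
  fderiv ℝ (connectionForm h e 1) y (e 2 y) - fderiv ℝ (connectionForm h e 2) y (e 1 y)
    - connectionForm h e 1 y ^ 2 - connectionForm h e 2 y ^ 2

/-- The tensor of curvature `-1` plus one term supported on the contact plane. The Jacobi relations
are what kill the mixed components containing derivatives of `a`, `b` and `c`. -/
theorem curvature_frame (A : IsAdaptedFrame h φ ξ Ω e) (K : IsKenmotsuOn h φ ξ η Ω)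
    (hE : Module.finrank ℝ E = 3) {y : E} (hy : y ∈ Ω) (i j k l : Fin 3) :
    h y (curvature h y (e i y) (e j y) (e k y)) (e l y)
      = (if i = k then 1 else 0) * (if j = l then 1 else 0)
        - (if j = k then 1 else 0) * (if i = l then 1 else 0)
        - curvatureExcess h e y * contactArea i j * contactArea k l := by
  rw [A.curvature_component K.toIsRiemannianOn (A.contDiffOn_frameConnection K.toIsRiemannianOn)
    (fun y hy i j => A.covDeriv_frame K hE hy i j) hy]
  obtain ⟨ja, jb⟩ := (A.isKenmotsuFrame K hE).jacobi hy
  simp only [curvatureExcess]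
  generalize hw : connectionForm h e = w at *
  fin_cases i <;> fin_cases j <;> fin_cases k <;> fin_cases l <;>
    simp [Fin.sum_univ_three, frameConnection, contactArea] <;> linarith

end IsAdaptedFrame

end AdaptedFrame

/-! ### The soliton equation in a frame and local rigidity -/

section LocalRigidity

variable {E : Type*} [NormedAddCommGroup E] [NormedSpace ℝ E]
  {h : E → E →L[ℝ] E →L[ℝ] ℝ} {φ : E → E →L[ℝ] E} {ξ : E → E} {η : E → E →L[ℝ] ℝ} {Ω : Set E}
  {e : Fin 3 → E → E}

theorem curvature_add_left (y u u' v w : E) :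
    curvature h y (u + u') v w = curvature h y u v w + curvature h y u' v w := by
  simp [curvature]; abel

theorem curvature_smul_left (y : E) (c : ℝ) (u v w : E) :
    curvature h y (c • u) v w = c • curvature h y u v w := by
  simp [curvature, smul_sub, smul_add]

theorem curvature_swap (y u v w : E) : curvature h y u v w = -curvature h y v u w := by
  simp [curvature]; abel

theorem IsOrthonormalFrame.induction (F : IsOrthonormalFrame h Ω e)
    (hE : Module.finrank ℝ E = 3) {y : E} (hy : y ∈ Ω) {P : E → Prop} (hP : ∀ i, P (e i y))
    (hadd : ∀ u v, P u → P v → P (u + v)) (hsmul : ∀ (c : ℝ) u, P u → P (c • u)) (u : E) : P u := by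
  rw [F.eq_sum hE hy u]
  refine Finset.sum_induction _ P hadd ?_ fun i _ => hsmul _ _ (hP i)
  simpa using hsmul 0 _ (hP 0)

/-- Strict Cauchy–Schwarz: the squared length of `h(v,v) u - h(u,v) v` is `h(v,v)` times the Gram
determinant. -/
theorem IsRiemannianOn.gram_pos (H : IsRiemannianOn h Ω) {y : E} (hy : y ∈ Ω) {u v : E}
    (huv : LinearIndependent ℝ ![u, v]) : 0 < h y u u * h y v v - h y u v ^ 2 := by
  have hv : v ≠ 0 := huv.ne_zero 1
  have hvv := H.pos y hy v hv
  have hw : h y v v • u - h y u v • v ≠ 0 := fun h0 => by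
    have := LinearIndependent.pair_iff.1 huv (h y v v) (-h y u v)
      (by rw [neg_smul, ← sub_eq_add_neg, h0])
    exact hvv.ne' this.1
  have := H.pos y hy _ hw
  simp only [map_sub, map_smul, _root_.sub_apply, smul_apply, smul_eq_mul, H.symm y hy v u] at this
  refine (mul_pos_iff_of_pos_left hvv).1 ?_
  linarith

namespace IsAdaptedFrame

theorem frame_φ (A : IsAdaptedFrame h φ ξ Ω e) (K : IsKenmotsuOn h φ ξ η Ω) {y : E} (hy : y ∈ Ω)
    (j : Fin 3) : φ y (e j y) = ∑ m, contactArea j m • e m y := by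
  fin_cases j
  · simpa [contactArea, A.frame_zero, Fin.sum_univ_three] using K.φ_ξ hy
  · simpa [contactArea, Fin.sum_univ_three] using A.φ_one y hy
  · simpa [contactArea, Fin.sum_univ_three] using A.φ_two y hy

variable [FiniteDimensional ℝ E]

theorem starRicci_frame (A : IsAdaptedFrame h φ ξ Ω e) (K : IsKenmotsuOn h φ ξ η Ω)
    (hE : Module.finrank ℝ E = 3) {y : E} (hy : y ∈ Ω) (i j : Fin 3) :
    starRicci h φ y (e i y) (e j y) = (curvatureExcess h e y - 1) *
      ((if i = j then 1 else 0) - (if i = 0 then 1 else 0) * (if j = 0 then 1 else 0)) := by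
  have hsw : ∀ v w l, h y (curvature h y (e i y) v w) (e l y)
      = -h y (curvature h y v (e i y) w) (e l y) := fun v w l => by
    rw [curvature_swap]; simp
  rw [starRicci, A.trace_eq hE hy]
  simp only [ContinuousLinearMap.comp_apply, A.frame_φ K hy, Fin.sum_univ_three, map_add, map_smul,
    hsw, curvature_add_left, curvature_smul_left, _root_.add_apply, smul_apply,
    A.curvature_frame K hE hy]
  fin_cases i <;> fin_cases j <;> simp [contactArea] <;> ring

theorem covDeriv_component (A : IsAdaptedFrame h φ ξ Ω e) (K : IsKenmotsuOn h φ ξ η Ω)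
    (hE : Module.finrank ℝ E = 3) {V : E → E} (hV : ContDiffOn ℝ ∞ V Ω) {y : E} (hy : y ∈ Ω)
    (i k : Fin 3) :
    h y (covDeriv h (e i) V y) (e k y) = fderiv ℝ (fun z => h z (V z) (e k z)) y (e i y)
      + ∑ j, h y (V y) (e j y) * frameConnection (connectionForm h e i y) i j k := by
  rw [covDeriv_sum_smul_right K.isOpen Finset.univ (fun j z => h z (V z) (e j z)) e
    (fun j => K.contDiffOn_metric hV (A.smooth j)) A.smooth (e i) V
    (fun z hz => A.eq_sum hE hz (V z)) hy]
  simp [A.covDeriv_frame K hE hy, sum_apply, A.orthonormal y hy, Finset.sum_add_distrib]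

/-- The six frame components of the soliton equation are the hypotheses of
`IsKenmotsuFrame.curvature_eq_zero`, with `f, p, q` the components of `V`. -/
theorem curvatureExcess_eq_zero (A : IsAdaptedFrame h φ ξ Ω e) (K : IsKenmotsuOn h φ ξ η Ω)
    (hE : Module.finrank ℝ E = 3) {V : E → E} (hV : ContDiffOn ℝ ∞ V Ω) (c : ℝ)
    (hS : ∀ y ∈ Ω, ∀ u v,
      lieDerivMetric h V y u v + 2 * starRicci h φ y u v + 2 * c * h y u v = 0)
    {y : E} (hy : y ∈ Ω) : curvatureExcess h e y = 0 := by
  have key : ∀ y ∈ Ω, ∀ i j : Fin 3, _ := fun y hy i j => by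
    have := hS y hy (e i y) (e j y)
    rw [K.lieDerivMetric_eq V (e i) (e j) hy, K.symm y hy (e i y),
      A.covDeriv_component K hE hV hy, A.covDeriv_component K hE hV hy,
      A.starRicci_frame K hE hy, A.orthonormal y hy] at this
    simp only [Fin.sum_univ_three] at this
    exact this
  refine (A.isKenmotsuFrame K hE).curvature_eq_zero c
    (K.contDiffOn_metric hV (A.smooth 0)) (K.contDiffOn_metric hV (A.smooth 1))
    (K.contDiffOn_metric hV (A.smooth 2)) (fun y hy => ?_) (fun y hy => ?_) (fun y hy => ?_)
    (fun y hy => ?_) (fun y hy => ?_) (fun y hy => ?_) hy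
  · have := key y hy 0 0
    simp [frameConnection] at this
    linarith
  · have := key y hy 0 1
    simp [frameConnection] at this
    linarith
  · have := key y hy 0 2
    simp [frameConnection] at this
    linarith
  · have := key y hy 1 1
    simp [frameConnection, curvatureExcess] at this
    linarith
  · have := key y hy 2 2
    simp [frameConnection, curvatureExcess] at this
    linarith
  · have := key y hy 1 2
    simp [frameConnection] at this
    linarith

theorem curvature_eq_of_excess_eq_zero (A : IsAdaptedFrame h φ ξ Ω e) (K : IsKenmotsuOn h φ ξ η Ω)
    (hE : Module.finrank ℝ E = 3) {y : E} (hy : y ∈ Ω) (hr : curvatureExcess h e y = 0)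
    (u v w z : E) :
    h y (curvature h y u v w) z = h y u w * h y v z - h y v w * h y u z := by
  have ind := fun {P : E → Prop} => A.induction hE hy (P := P)
  revert u v w z
  -- Both sides are multilinear in the four vectors, so frame vectors suffice; `curvature_swap`
  -- moves the second slot to the first.
  refine ind (fun i => ind (fun j => ind (fun k => ind (fun l => ?_) ?_ ?_) ?_ ?_) ?_ ?_) ?_ ?_
  · rw [A.curvature_frame K hE hy, hr]
    simp [A.orthonormal y hy]
  · intro z z' hz hz'
    simp only [map_add, hz, hz']; ring
  · intro c z hz
    simp only [map_smul, hz, smul_eq_mul]; ring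
  · intro w w' hw hw' z
    simp only [map_add, _root_.add_apply, hw, hw']; ring
  · intro c w hw z
    simp only [map_smul, smul_apply, hw, smul_eq_mul]; ring
  · intro v v' hv hv' w z
    rw [curvature_swap, curvature_add_left, neg_add, ← curvature_swap, ← curvature_swap]
    simp only [map_add, _root_.add_apply, hv, hv']; ring
  · intro c v hv w z
    rw [curvature_swap, curvature_smul_left, ← smul_neg, ← curvature_swap]
    simp only [map_smul, smul_apply, hv, smul_eq_mul]; ring
  · intro u u' hu hu' v w z
    rw [curvature_add_left]
    simp only [map_add, _root_.add_apply, hu, hu']; ring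
  · intro c u hu v w z
    rw [curvature_smul_left]
    simp only [map_smul, smul_apply, hu, smul_eq_mul]; ring

end IsAdaptedFrame

/-- A three-dimensional Kenmotsu `*`-Ricci soliton on a coordinate domain is hyperbolic. -/
theorem IsKenmotsuOn.sectionalCurvature_eq [FiniteDimensional ℝ E] (K : IsKenmotsuOn h φ ξ η Ω)
    (hE : Module.finrank ℝ E = 3) {V : E → E} (hV : ContDiffOn ℝ ∞ V Ω) (c : ℝ)
    (hS : ∀ y ∈ Ω, ∀ u v,
      lieDerivMetric h V y u v + 2 * starRicci h φ y u v + 2 * c * h y u v = 0)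
    {y : E} (hy : y ∈ Ω) {u v : E} (huv : LinearIndependent ℝ ![u, v]) :
    sectionalCurvature h y u v = -1 := by
  obtain ⟨Ω', hsub, hy', hop, e, A⟩ := K.exists_adaptedFrame hE hy
  have K' := K.restrict hop hsub
  have hr := A.curvatureExcess_eq_zero K' hE (hV.mono hsub) c (fun z hz => hS z (hsub hz)) hy'
  rw [sectionalCurvature, A.curvature_eq_of_excess_eq_zero K' hE hy' hr,
    div_eq_iff (K.gram_pos hy huv).ne', K.symm y hy v u]
  ring

end LocalRigidity

/-! ### Coordinate expressions of smooth tensor fields -/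

section CoordinateExpressions

variable {E : Type*} [NormedAddCommGroup E] [NormedSpace ℝ E]
  {M : Type*} [TopologicalSpace M] [ChartedSpace E M] [IsManifold 𝓘(ℝ, E) ∞ M]

omit [IsManifold 𝓘(ℝ, E) ∞ M] in
theorem extChartAt_symm_mem_source (x₀ : M) {y : E} (hy : y ∈ (extChartAt 𝓘(ℝ, E) x₀).target) :
    (extChartAt 𝓘(ℝ, E) x₀).symm y ∈ (chartAt E x₀).source := by
  rw [← extChartAt_source (I := 𝓘(ℝ, E))]
  exact (extChartAt 𝓘(ℝ, E) x₀).map_target hy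

theorem toCoord_fromCoord (x₀ : M) {y : E} (hy : y ∈ (extChartAt 𝓘(ℝ, E) x₀).target) (u : E) :
    toCoord x₀ y (fromCoord x₀ y u) = u := by
  have : IsManifold 𝓘(ℝ, E) 1 M := .of_le (n := ∞) (by simp)
  have h := mfderiv_extChartAt_comp_mfderivWithin_extChartAt_symm (I := 𝓘(ℝ, E)) (x := x₀) hy
  rw [modelWithCornersSelf_coe, Set.range_id, mfderivWithin_univ] at h
  exact congrArg (fun L : E →L[ℝ] E => L u) h

theorem fromCoord_toCoord (x₀ : M) {y : E} (hy : y ∈ (extChartAt 𝓘(ℝ, E) x₀).target)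
    (u : TangentSpace 𝓘(ℝ, E) ((extChartAt 𝓘(ℝ, E) x₀).symm y)) :
    fromCoord x₀ y (toCoord x₀ y u) = u := by
  have : IsManifold 𝓘(ℝ, E) 1 M := .of_le (n := ∞) (by simp)
  have h := mfderivWithin_extChartAt_symm_comp_mfderiv_extChartAt (I := 𝓘(ℝ, E)) (x := x₀) hy
  rw [modelWithCornersSelf_coe, Set.range_id, mfderivWithin_univ] at h
  exact congrArg (fun L : E →L[ℝ] E => L u) h

/-- A vector field along the inverse chart is smooth iff its coordinate expression is. -/
theorem contMDiffOn_symm_iff (x₀ : M)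
    (v : (y : E) → TangentSpace 𝓘(ℝ, E) ((extChartAt 𝓘(ℝ, E) x₀).symm y)) :
    ContMDiffOn 𝓘(ℝ, E) (𝓘(ℝ, E).prod 𝓘(ℝ, E)) ∞
      (fun y => Bundle.TotalSpace.mk' E ((extChartAt 𝓘(ℝ, E) x₀).symm y) (v y))
      (extChartAt 𝓘(ℝ, E) x₀).target ↔
    ContDiffOn ℝ ∞ (fun y => toCoord x₀ y (v y)) (extChartAt 𝓘(ℝ, E) x₀).target := by
  have : IsManifold 𝓘(ℝ, E) 1 M := .of_le (n := ∞) (by simp)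
  have hmaps : Set.MapsTo
      (fun y => Bundle.TotalSpace.mk' E ((extChartAt 𝓘(ℝ, E) x₀).symm y) (v y))
      (extChartAt 𝓘(ℝ, E) x₀).target
      (trivializationAt E (TangentSpace 𝓘(ℝ, E)) x₀).source := fun y hy => by
    rw [Bundle.Trivialization.mem_source]
    exact extChartAt_symm_mem_source x₀ hy
  rw [Bundle.Trivialization.contMDiffOn_iff hmaps]
  have hbase : ContMDiffOn 𝓘(ℝ, E) 𝓘(ℝ, E) ∞ (extChartAt 𝓘(ℝ, E) x₀).symm
      (extChartAt 𝓘(ℝ, E) x₀).target := contMDiffOn_extChartAt_symm x₀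
  rw [← contMDiffOn_iff_contDiffOn]
  refine (and_iff_right hbase).trans (contMDiffOn_congr fun y hy => ?_)
  have hs := extChartAt_symm_mem_source x₀ hy
  -- The trivialization at `x₀` acts on fibres as the derivative of the chart.
  rw [toCoord, ← TangentBundle.continuousLinearMapAt_trivializationAt hs,
    Bundle.Trivialization.continuousLinearMapAt_apply,
    Bundle.Trivialization.coe_linearMapAt_of_mem _ hs]

theorem contMDiffOn_fromCoord (x₀ : M) (u : E) :
    ContMDiffOn 𝓘(ℝ, E) (𝓘(ℝ, E).prod 𝓘(ℝ, E)) ∞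
      (fun y => Bundle.TotalSpace.mk' E ((extChartAt 𝓘(ℝ, E) x₀).symm y) (fromCoord x₀ y u))
      (extChartAt 𝓘(ℝ, E) x₀).target :=
  (contMDiffOn_symm_iff x₀ _).2 <|
    contDiffOn_const.congr fun _ hy => toCoord_fromCoord x₀ hy u

theorem contDiffOn_coordVector {X : (x : M) → TangentSpace 𝓘(ℝ, E) x}
    (hX : ContMDiff 𝓘(ℝ, E) (𝓘(ℝ, E).prod 𝓘(ℝ, E)) ∞
      (fun x ↦ Bundle.TotalSpace.mk' E x (X x))) (x₀ : M) :
    ContDiffOn ℝ ∞ (coordVector X x₀) (extChartAt 𝓘(ℝ, E) x₀).target :=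
  (contMDiffOn_symm_iff x₀ _).1 <| hX.comp_contMDiffOn (contMDiffOn_extChartAt_symm x₀)

/-- In finite dimension an operator-valued map is smooth once its values on fixed vectors are. -/
theorem contDiffOn_coordEndo [FiniteDimensional ℝ E]
    {φ : (x : M) → TangentSpace 𝓘(ℝ, E) x →L[ℝ] TangentSpace 𝓘(ℝ, E) x}
    (hφ : ContMDiff 𝓘(ℝ, E) (𝓘(ℝ, E).prod 𝓘(ℝ, E →L[ℝ] E)) ∞
      (fun x ↦ Bundle.TotalSpace.mk' (E →L[ℝ] E) x (φ x))) (x₀ : M) :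
    ContDiffOn ℝ ∞ (coordEndo φ x₀) (extChartAt 𝓘(ℝ, E) x₀).target :=
  contDiffOn_clm_apply.2 fun u => (contMDiffOn_symm_iff x₀ _).1 <|
    (hφ.comp_contMDiffOn (contMDiffOn_extChartAt_symm x₀)).clm_bundle_apply
      (contMDiffOn_fromCoord x₀ u)

theorem contDiffOn_coordBilin [FiniteDimensional ℝ E]
    (g : Bundle.ContMDiffRiemannianMetric 𝓘(ℝ, E) ∞ E (fun x : M ↦ TangentSpace 𝓘(ℝ, E) x))
    (x₀ : M) :
    ContDiffOn ℝ ∞ (coordBilin g.inner x₀) (extChartAt 𝓘(ℝ, E) x₀).target := by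
  refine contDiffOn_clm_apply.2 fun u => contDiffOn_clm_apply.2 fun v => ?_
  have : ContMDiffOn 𝓘(ℝ, E) (𝓘(ℝ, E).prod 𝓘(ℝ, ℝ)) ∞
      (fun y ↦ Bundle.TotalSpace.mk' ℝ (E := Bundle.Trivial M ℝ) ((extChartAt 𝓘(ℝ, E) x₀).symm y)
        (g.inner ((extChartAt 𝓘(ℝ, E) x₀).symm y) (fromCoord x₀ y u) (fromCoord x₀ y v)))
      (extChartAt 𝓘(ℝ, E) x₀).target :=
    (g.contMDiff.comp_contMDiffOn (contMDiffOn_extChartAt_symm x₀)).clm_bundle_apply₂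
      (F₁ := E) (F₂ := E) (contMDiffOn_fromCoord x₀ u) (contMDiffOn_fromCoord x₀ v)
  rw [← contMDiffOn_iff_contDiffOn]
  exact fun y hy => (Bundle.contMDiffWithinAt_totalSpace.1 (this y hy)).2

theorem AlmostContactMetric.IsKenmotsu.isKenmotsuOn [FiniteDimensional ℝ E]
    {A : AlmostContactMetric E M} (hA : A.IsKenmotsu) (x₀ : M) :
    IsKenmotsuOn (coordBilin A.g.inner x₀) (coordEndo A.φ x₀) (coordVector A.ξ x₀)
      (coordForm A.η x₀) (extChartAt 𝓘(ℝ, E) x₀).target where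
  isOpen := isOpen_extChartAt_target x₀
  smooth := contDiffOn_coordBilin A.g x₀
  symm y _ u v := A.g.symm _ _ _
  pos y hy u hu := A.g.pos _ _ fun h0 => hu <|
    (toCoord_fromCoord x₀ hy u).symm.trans <|
      (congrArg (toCoord x₀ y) h0).trans (map_zero (toCoord x₀ y))
  smooth_φ := contDiffOn_coordEndo A.contMDiff_φ x₀
  smooth_ξ := contDiffOn_coordVector A.contMDiff_ξ x₀
  φ_φ y hy u := by
    simp only [coordEndo, coordForm, coordVector, ContinuousLinearMap.comp_apply]
    rw [fromCoord_toCoord x₀ hy, A.φ_φ, map_add, map_neg, map_smul, toCoord_fromCoord x₀ hy]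
  η_ξ y hy := by
    simp only [coordForm, coordVector, ContinuousLinearMap.comp_apply]
    rw [fromCoord_toCoord x₀ hy, A.η_ξ]
  h_φ_φ y hy u v := by
    simp only [coordBilin_apply, coordEndo, coordForm, ContinuousLinearMap.comp_apply]
    rw [fromCoord_toCoord x₀ hy, fromCoord_toCoord x₀ hy, A.g_φ_φ]
  covDerivEndo_eq' := hA x₀

end CoordinateExpressions

end KenmotsuGeometry

theorem theorem3p3 {M : Type*} [TopologicalSpace M]
    [ChartedSpace (EuclideanSpace ℝ (Fin 3)) M]
    [IsManifold 𝓘(ℝ, EuclideanSpace ℝ (Fin 3)) ∞ M]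
    (A : KenmotsuGeometry.AlmostContactMetric (EuclideanSpace ℝ (Fin 3)) M)
    (hK : A.IsKenmotsu) (hS : A.IsStarRicciSoliton) :
    KenmotsuGeometry.HasConstantSectionalCurvature A.g (-1) := by
  obtain ⟨c, V, hV, hsol⟩ := hS
  exact fun x₀ y hy u v huv => (hK.isKenmotsuOn x₀).sectionalCurvature_eq
    (by simp) (KenmotsuGeometry.contDiffOn_coordVector hV x₀) c (hsol x₀) hy huv
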